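/- Let $T$ be a text of length $n-1$ ($n\ge 1$) over an integer alphabet, and let $T\$$ be $T$ followed by an end marker $\$$ that does not occur in $T$ and is smaller than all letters. For a factor $p$ of $T\$$ (possibly empty), the *suffix-array interval* of $p$ is the interval $[i..j]\subseteq[1..n]$ of the ranks, in the lexicographic order of the $n$ non-empty suffixes of $T\$$, of the suffixes that have $p$ as a prefix. The *suffix tree* of $T$ is the compacted trie of all these suffixes (loci with a single outgoing edge are contracted, and children are ordered by the first letters of their edges). Its topology is represented by its balanced-parenthesis sequence: for every node, an opening parenthesis, then the sequences of its children from left to right, then a closing parenthesis. An *enumerator* is a black box with a call that (re)starts an enumeration and a call that delivers the next interval or reports the end; each call takes at least one time unit. It enumerates the suffix-array intervals in $t_e$ time per interval if, whenever it is started, it delivers every suffix-array interval of $T\$$ exactly once, in any order, and the whole enumeration takes at most $t_e$ time units per call on average. **Lemma.** Consider the unit-cost word RAM whose words have $w=\Theta(\log n)$ bits, that is, $\lfloor\log_2 n\rfloor+\kappa\le w\le a(\lfloor\log_2 n\rfloor+1)$, where $\kappa$ is a suitable absolute constant and $a$ is an arbitrary constant. There is a single program that, for every $T$ and every enumerator of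 the suffix-array intervals of $T\$$ in $t_e$ time per interval, given $n$, $w$ and access to the enumerator (but not to $T$), writes the balanced-parenthesis sequence of the suffix tree of $T$ to memory, as a packed bit sequence, in $O(n\cdot t_e)$ time (the time of the enumerator included), and uses $O(n)$ bits of space in addition to that of the enumerator (the space for the output included). The constants in the $O$-bounds depend only on $a$. -/

import Mathlib

namespace TreeTopology

/-! ### Texts, suffix arrays and suffix-array intervals -/

/-- The text `T$`: the letters of `T` become `1, …, σ`, and the end marker `$` is `0`, which is
smaller than every letter and does not occur in `T`. -/
def terminated {σ : ℕ} (T : List (Fin σ)) : List (Fin (σ + 1)) :=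
  T.map Fin.succ ++ [0]

/-- The suffix of `S` that starts at the (1-based) position `j`. -/
def suffixAt {σ : ℕ} (S : List (Fin σ)) (j : ℕ) : List (Fin σ) :=
  S.drop (j - 1)

/-- The suffix array: the starting positions `1, …, |S|` of the non-empty suffixes of `S`, in the
lexicographic order of these suffixes. -/
def suffixArray {σ : ℕ} (S : List (Fin σ)) : List ℕ :=
  (List.range' 1 S.length).mergeSort (fun i j => decide (suffixAt S i ≤ suffixAt S j))

/-- `I = (i, j)` is the suffix-array interval of the string `p`: the entries of the suffix array
at ranks `i, …, j` (ranks are 1-based) are exactly those of the suffixes of `S` with prefix `p`. -/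
def IsIntervalOf {σ : ℕ} (S p : List (Fin σ)) (I : ℕ × ℕ) : Prop :=
  1 ≤ I.1 ∧ I.1 ≤ I.2 ∧ I.2 ≤ S.length ∧
    ∀ (r : ℕ) (hr : r < (suffixArray S).length),
      p <+: suffixAt S (suffixArray S)[r] ↔ I.1 ≤ r + 1 ∧ r + 1 ≤ I.2

/-- `I` is a suffix-array interval of `S`: the interval of some factor `p` of `S` (the empty
factor included). -/
def IsInterval {σ : ℕ} (S : List (Fin σ)) (I : ℕ × ℕ) : Prop :=
  ∃ p : List (Fin σ), p <:+: S ∧ IsIntervalOf S p I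

/-! ### Suffix trees and balanced parentheses -/

/-- Finite rooted ordered trees (tree shapes). -/
inductive OrdTree : Type
  | node (children : List OrdTree) : OrdTree

/-- The balanced-parenthesis sequence of an ordered tree; `true` is an opening and `false` a
closing parenthesis. -/
def OrdTree.bp : OrdTree → List Bool
  | .node ts => true :: (ts.flatMap fun t => t.bp) ++ [false]

/-- The letters `c` such that `pc` is a factor of `S`, in increasing order: the labels of the
edges that leave the locus `p` in the (non-compacted) trie of all suffixes of `S`. -/
def nextLetters {σ : ℕ} (S p : List (Fin σ)) : List (Fin σ) :=
  (List.finRange σ).filter fun c => decide ((p ++ [c]) <:+: S)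

/-- The part below the locus `p` of the compacted trie of all suffixes of `S`: a locus with a
single outgoing letter is contracted, and the children of a branching locus are ordered by their
letters. The number `d` bounds the depth; a factor `p` of `S` can be extended at most
`|S| - |p|` times, so `d = |S| - |p|` gives all of it. -/
def compactTrie {σ : ℕ} (S : List (Fin σ)) : ℕ → List (Fin σ) → OrdTree
  | 0, _ => .node []
  | d + 1, p =>
    match nextLetters S p with
    | [] => .node []
    | [c] => compactTrie S d (p ++ [c])
    | c₁ :: c₂ :: cs =>
      .node ((c₁ :: c₂ :: cs).map fun c => compactTrie S d (p ++ [c]))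

/-- The suffix tree (its topology) of the text `T`: the compacted trie of all suffixes of `T$`. -/
def suffixTree {σ : ℕ} (T : List (Fin σ)) : OrdTree :=
  compactTrie (terminated T) (terminated T).length []

/-! ### Interval enumerators -/

/-- A sequential enumerator, given as a black box with an internal state: `start` (re)starts the
enumeration and `next` delivers the next pair, or `none` at the end. Every call takes a number of
time units, at least one. -/
structure Enumerator where
  State : Type
  start : State → State
  next : State → Option (ℕ × ℕ) × State
  startCost : State → ℕ
  nextCost : State → ℕ
  one_le_startCost : ∀ s, 1 ≤ startCost s
  one_le_nextCost : ∀ s, 1 ≤ nextCost s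

/-- `E.Yields s l c`: repeated calls of `next` from the state `s` deliver the list `l` and then
report the end, and these `l.length + 1` calls take `c` time units altogether. -/
inductive Enumerator.Yields (E : Enumerator) : E.State → List (ℕ × ℕ) → ℕ → Prop
  | done (s : E.State) (h : (E.next s).1 = none) : Enumerator.Yields E s [] (E.nextCost s)
  | more (s : E.State) (I : ℕ × ℕ) (l : List (ℕ × ℕ)) (c : ℕ) (h : (E.next s).1 = some I)
      (hl : Enumerator.Yields E (E.next s).2 l c) :
      Enumerator.Yields E s (I :: l) (E.nextCost s + c)

/-- `E` enumerates the suffix-array intervals of `S` in (amortised) time `t` per interval: whenever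
it is started, it delivers every suffix-array interval exactly once, in some order, and the whole
enumeration (the call of `start`, one call of `next` for each interval, and the call that reports
the end) takes at most `t` time units per call on average. -/
def Enumerator.EnumeratesIntervals (E : Enumerator) {σ : ℕ} (S : List (Fin σ)) (t : ℝ) : Prop :=
  ∀ s : E.State, ∃ (l : List (ℕ × ℕ)) (c : ℕ), E.Yields (E.start s) l c ∧
    l.Nodup ∧ (∀ I : ℕ × ℕ, I ∈ l ↔ IsInterval S I) ∧
    ((E.startCost s + c : ℕ) : ℝ) ≤ t * (l.length + 2)

/-! ### The unit-cost word RAM -/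

/-- The binary operations on words. -/
inductive BinOp : Type
  | add | sub | mul | div | mod | and | or | xor | shl | shr | eq | lt

/-- The value of a binary operation on `w`-bit words (arithmetic is unsigned and modulo `2 ^ w`;
truth values are the words `0` and `1`). -/
def BinOp.eval {w : ℕ} : BinOp → BitVec w → BitVec w → BitVec w
  | .add, x, y => x + y
  | .sub, x, y => x - y
  | .mul, x, y => x * y
  | .div, x, y => x / y
  | .mod, x, y => x % y
  | .and, x, y => x &&& y
  | .or, x, y => x ||| y
  | .xor, x, y => x ^^^ y
  | .shl, x, y => x <<< y.toNat
  | .shr, x, y => x >>> y.toNat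
  | .eq, x, y => if x = y then 1 else 0
  | .lt, x, y => if x.toNat < y.toNat then 1 else 0

/-- Expressions over `k` registers. -/
inductive Expr (k : ℕ) : Type
  | const (c : ℕ) : Expr k
  | reg (r : Fin k) : Expr k
  | bin (o : BinOp) (a b : Expr k) : Expr k

/-- The value of an expression, given the contents of the registers. -/
def Expr.eval {k w : ℕ} (ρ : Fin k → BitVec w) : Expr k → BitVec w
  | .const c => BitVec.ofNat w c
  | .reg r => ρ r
  | .bin o a b => o.eval (a.eval ρ) (b.eval ρ)

/-- The time to evaluate an expression: one unit for each operation. -/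
def Expr.cost {k : ℕ} : Expr k → ℕ
  | .const _ => 0
  | .reg _ => 0
  | .bin _ a b => a.cost + b.cost + 1

/-- Word-RAM programs with `k` registers, random access to a memory of words, and access to an
enumerator. The programs do not depend on the word size. -/
inductive Prog (k : ℕ) : Type
  | skip : Prog k
  | assign (r : Fin k) (e : Expr k) : Prog k
  | load (r : Fin k) (addr : Expr k) : Prog k
  | store (addr val : Expr k) : Prog k
  | seq (p q : Prog k) : Prog k
  | branch (e : Expr k) (p q : Prog k) : Prog k
  | loop (e : Expr k) (p : Prog k) : Prog k
  | start : Prog k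
  | next (flag left right : Fin k) : Prog k

/-- A configuration of the machine with word size `w`, coupled to the enumerator `E`. -/
structure Config (k w : ℕ) (E : Enumerator) where
  regs : Fin k → BitVec w
  mem : ℕ → BitVec w
  enum : E.State

/-- `Exec E w M p s t s'`: the program `p`, run on words of `w` bits with the enumerator `E` from
the configuration `s`, touches no memory cell outside the cells `0, …, M - 1`, and halts after
exactly `t` time units in the configuration `s'`. -/
inductive Exec {k : ℕ} (E : Enumerator) (w M : ℕ) :
    Prog k → Config k w E → ℕ → Config k w E → Prop
  | skip (s : Config k w E) : Exec E w M .skip s 1 s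
  | assign (r : Fin k) (e : Expr k) (s : Config k w E) :
      Exec E w M (.assign r e) s (e.cost + 1)
        { s with regs := Function.update s.regs r (e.eval s.regs) }
  | load (r : Fin k) (a : Expr k) (s : Config k w E) (h : (a.eval s.regs).toNat < M) :
      Exec E w M (.load r a) s (a.cost + 1)
        { s with regs := Function.update s.regs r (s.mem (a.eval s.regs).toNat) }
  | store (a v : Expr k) (s : Config k w E) (h : (a.eval s.regs).toNat < M) :
      Exec E w M (.store a v) s (a.cost + v.cost + 1)
        { s with mem := Function.update s.mem (a.eval s.regs).toNat (v.eval s.regs) }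
  | seq (p q : Prog k) (s s₁ s₂ : Config k w E) (t₁ t₂ : ℕ)
      (hp : Exec E w M p s t₁ s₁) (hq : Exec E w M q s₁ t₂ s₂) :
      Exec E w M (.seq p q) s (t₁ + t₂) s₂
  | branchTrue (e : Expr k) (p q : Prog k) (s s₁ : Config k w E) (t : ℕ)
      (he : e.eval s.regs ≠ 0) (hp : Exec E w M p s t s₁) :
      Exec E w M (.branch e p q) s (e.cost + 1 + t) s₁
  | branchFalse (e : Expr k) (p q : Prog k) (s s₁ : Config k w E) (t : ℕ)
      (he : e.eval s.regs = 0) (hq : Exec E w M q s t s₁) :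
      Exec E w M (.branch e p q) s (e.cost + 1 + t) s₁
  | loopTrue (e : Expr k) (p : Prog k) (s s₁ s₂ : Config k w E) (t₁ t₂ : ℕ)
      (he : e.eval s.regs ≠ 0) (hp : Exec E w M p s t₁ s₁)
      (hl : Exec E w M (.loop e p) s₁ t₂ s₂) :
      Exec E w M (.loop e p) s (e.cost + 1 + t₁ + t₂) s₂
  | loopFalse (e : Expr k) (p : Prog k) (s : Config k w E) (he : e.eval s.regs = 0) :
      Exec E w M (.loop e p) s (e.cost + 1) s
  | start (s : Config k w E) :
      Exec E w M .start s (E.startCost s.enum) { s with enum := E.start s.enum }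
  | nextSome (f a b : Fin k) (s : Config k w E) (i j : ℕ) (h : (E.next s.enum).1 = some (i, j)) :
      Exec E w M (.next f a b) s (E.nextCost s.enum)
        { s with
          regs := Function.update (Function.update (Function.update s.regs
            a (BitVec.ofNat w i)) b (BitVec.ofNat w j)) f 1
          enum := (E.next s.enum).2 }
  | nextNone (f a b : Fin k) (s : Config k w E) (h : (E.next s.enum).1 = none) :
      Exec E w M (.next f a b) s (E.nextCost s.enum)
        { s with
          regs := Function.update s.regs f 0
          enum := (E.next s.enum).2 }

/-- The `L.length` bits of `L` are stored in the memory cells `a, a + 1, …, a + ⌈|L| / w⌉ - 1`,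
`w` bits to a word, all of them among the cells `0, …, M - 1`. -/
def StoredBits {w : ℕ} (M : ℕ) (mem : ℕ → BitVec w) (a : ℕ) (L : List Bool) : Prop :=
  ∀ (i : ℕ) (hi : i < L.length), a + i / w < M ∧ (mem (a + i / w)).getLsbD (i % w) = L[i]

end TreeTopology

/-! The suffix-array intervals correspond bijectively to the nodes of the suffix tree: loci on one
contracted edge share their interval, and the intervals of the children of a branching node tile the
interval of that node. Hence the balanced-parenthesis sequence can be read off from the endpoints
alone. For the ranks 1, …, n in turn, write one opening parenthesis for every interval that starts
there, then one closing parenthesis for every interval that ends there. Only the numbers of left and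
right endpoints at each rank matter, not the order of delivery. This is `IsTrie.bp` and
`bp_suffixTree`, which also gives at most 2n - 1 intervals.

It remains to keep 2n + 2 counters with total at most 4n in O(n) bits, with constant time per
increment. Take h about a quarter of log₂ n and group the counters into chunks of h. A chunk is one
word: its counters in unary, separated by zero bits (`enc`). Incrementing a counter inserts a one
bit below the k-th zero bit (`ins`), by lookup in a table with 4^h · h entries, which is small as
4^h is about √n. When a chunk has collected h ones, its word is moved to a linked list of full words
belonging to the chunk, and the chunk restarts from h zero counters (`wp_increment`). Every full
word accounts for h increments, so there are at most 4n/h of them; as h is proportional to w, chunks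
and full words occupy O(n) bits (`space_le`).

Finally each chunk is decoded into h ordinary word counters and the corresponding runs of
parentheses are appended to a packed output (`runs_emitAll`). The memory consists, from address 0
on, of the table, the h unpacked counters, the two-cell records of the chunks (code word and link),
the pool of full records, and the output, which starts where the pool ends.

The correctness of the program is proved over natural numbers: straight-line code by weakest
preconditions (`Runs.of_wp`), loops by invariants that carry the remaining time (`Runs.loop`,
`Runs.enumerate`). -/

namespace TreeTopology

/-! ### Execution over natural numbers -/

/-- The contents of the registers and of the memory, as natural numbers. -/
@[ext] structure Store (k : ℕ) where
  reg : Fin k → ℕ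
  mem : ℕ → ℕ

/-- The store of a configuration. -/
def Config.store {k w : ℕ} {E : Enumerator} (s : Config k w E) : Store k :=
  ⟨fun r => (s.regs r).toNat, fun i => (s.mem i).toNat⟩

/-- The value of a binary operation in the absence of overflow. -/
def BinOp.nat : BinOp → ℕ → ℕ → ℕ
  | .add, x, y => x + y
  | .sub, x, y => x - y
  | .mul, x, y => x * y
  | .div, x, y => x / y
  | .mod, x, y => x % y
  | .and, x, y => x &&& y
  | .or, x, y => x ||| y
  | .xor, x, y => x ^^^ y
  | .shl, x, y => x <<< y
  | .shr, x, y => x >>> y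
  | .eq, x, y => if x = y then 1 else 0
  | .lt, x, y => if x < y then 1 else 0

/-- The operation does not overflow `w` bits. -/
def BinOp.Fits (w : ℕ) : BinOp → ℕ → ℕ → Prop
  | .add, x, y => x + y < 2 ^ w
  | .sub, x, y => y ≤ x
  | .mul, x, y => x * y < 2 ^ w
  | .shl, x, y => x <<< y < 2 ^ w
  | _, _, _ => True

/-- The value of an expression in the absence of overflow. -/
def Expr.nat {k : ℕ} (ρ : Fin k → ℕ) : Expr k → ℕ
  | .const c => c
  | .reg r => ρ r
  | .bin o a b => o.nat (a.nat ρ) (b.nat ρ)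

/-- No operation in the evaluation of the expression overflows `w` bits. -/
def Expr.Fits {k : ℕ} (w : ℕ) (ρ : Fin k → ℕ) : Expr k → Prop
  | .const c => c < 2 ^ w
  | .reg _ => True
  | .bin o a b => a.Fits w ρ ∧ b.Fits w ρ ∧ o.Fits w (a.nat ρ) (b.nat ρ)

/-- Positivity of `w` is needed for the comparisons only: in words of no bits the truth value 1
would be 0. -/
theorem BinOp.toNat_eval {w : ℕ} (hw : 0 < w) (o : BinOp) (x y : BitVec w)
    (h : o.Fits w x.toNat y.toNat) : (o.eval x y).toNat = o.nat x.toNat y.toNat := by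
  cases o <;> simp only [BinOp.eval, BinOp.nat, BinOp.Fits] at h ⊢
  · exact BitVec.toNat_add_of_lt h
  · exact BitVec.toNat_sub_of_le (BitVec.le_def.2 h)
  · exact BitVec.toNat_mul_of_lt h
  · exact BitVec.toNat_udiv
  · exact BitVec.toNat_umod
  · exact BitVec.toNat_and ..
  · exact BitVec.toNat_or ..
  · exact BitVec.toNat_xor ..
  · rw [BitVec.toNat_shiftLeft, Nat.mod_eq_of_lt h]
  · exact BitVec.toNat_ushiftRight ..
  · simp only [← BitVec.toNat_inj]; split_ifs <;> simp [hw]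
  · split_ifs <;> simp [hw]

theorem Expr.toNat_eval {k w : ℕ} (hw : 0 < w) (ρ : Fin k → BitVec w) (e : Expr k)
    (h : e.Fits w fun r => (ρ r).toNat) : (e.eval ρ).toNat = e.nat fun r => (ρ r).toNat := by
  induction e with
  | const c => simpa [Expr.eval, Expr.nat] using Nat.mod_eq_of_lt h
  | reg r => rfl
  | bin o a b iha ihb =>
    obtain ⟨ha, hb, ho⟩ := h
    have ia := iha ha
    have ib := ihb hb
    rw [← ia, ← ib] at ho
    rw [Expr.eval, BinOp.toNat_eval hw _ _ _ ho, ia, ib, Expr.nat]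

/-- From the store `s` and the state `e` of the enumerator, the program `p` halts within `T` time
units, using the cells `0, …, M - 1`, and the result satisfies `Q`. -/
def Runs {k : ℕ} (E : Enumerator) (w M : ℕ) (p : Prog k) (s : Store k) (e : E.State) (T : ℕ)
    (Q : Store k → E.State → Prop) : Prop :=
  ∀ c : Config k w E, c.store = s → c.enum = e →
    ∃ t c', Exec E w M p c t c' ∧ t ≤ T ∧ Q c'.store c'.enum

section Execution
variable {k w M : ℕ} {E : Enumerator}

theorem Runs.mono {p : Prog k} {s : Store k} {e : E.State} {T T' : ℕ}
    {Q Q' : Store k → E.State → Prop} (h : Runs E w M p s e T Q) (hT : T ≤ T')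
    (hQ : ∀ s e, Q s e → Q' s e) : Runs E w M p s e T' Q' := by
  intro c hc he
  obtain ⟨t, c', hx, ht, hq⟩ := h c hc he
  exact ⟨t, c', hx, ht.trans hT, hQ _ _ hq⟩

theorem Runs.seq {p q : Prog k} {s : Store k} {e : E.State} {T₁ T₂ : ℕ}
    {R Q : Store k → E.State → Prop} (hp : Runs E w M p s e T₁ R)
    (hq : ∀ s e, R s e → Runs E w M q s e T₂ Q) : Runs E w M (.seq p q) s e (T₁ + T₂) Q := by
  intro c hc he
  obtain ⟨t, c', hx, ht, hr⟩ := hp c hc he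
  obtain ⟨t', c₂, hx', ht', hr₂⟩ := hq _ _ hr c' rfl rfl
  exact ⟨t + t', c₂, .seq _ _ _ _ _ _ _ hx hx', by omega, hr₂⟩

/-- The weakest precondition of a program without loops and calls of the enumerator. -/
def Prog.wp (w M : ℕ) : Prog k → (Store k → Prop) → Store k → Prop
  | .skip, Q, s => Q s
  | .assign r e, Q, s => e.Fits w s.reg ∧ Q ⟨Function.update s.reg r (e.nat s.reg), s.mem⟩
  | .load r a, Q, s => a.Fits w s.reg ∧ a.nat s.reg < M ∧
      Q ⟨Function.update s.reg r (s.mem (a.nat s.reg)), s.mem⟩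
  | .store a v, Q, s => a.Fits w s.reg ∧ v.Fits w s.reg ∧ a.nat s.reg < M ∧
      Q ⟨s.reg, Function.update s.mem (a.nat s.reg) (v.nat s.reg)⟩
  | .seq p q, Q, s => p.wp w M (q.wp w M Q) s
  | .branch e p q, Q, s => e.Fits w s.reg ∧ (e.nat s.reg ≠ 0 → p.wp w M Q s) ∧
      (e.nat s.reg = 0 → q.wp w M Q s)
  | .loop _ _, _, _ => False
  | .start, _, _ => False
  | .next _ _ _, _, _ => False

/-- A bound on the time of a program without loops and calls of the enumerator. -/
def Prog.time : Prog k → ℕ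
  | .skip => 1
  | .assign _ e => e.cost + 1
  | .load _ a => a.cost + 1
  | .store a v => a.cost + v.cost + 1
  | .seq p q => p.time + q.time
  | .branch e p q => e.cost + 1 + max p.time q.time
  | .loop _ _ => 0
  | .start => 0
  | .next _ _ _ => 0

theorem Config.store_update_reg (c : Config k w E) (r : Fin k) (v : BitVec w) :
    Config.store { c with regs := Function.update c.regs r v } =
      ⟨Function.update c.store.reg r v.toNat, c.store.mem⟩ := by
  ext i
  · by_cases h : i = r
    · subst h; simp [Config.store]
    · simp [Config.store, Function.update_of_ne h]
  · rfl

theorem Config.store_update_mem (c : Config k w E) (a : ℕ) (v : BitVec w) :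
    Config.store { c with mem := Function.update c.mem a v } =
      ⟨c.store.reg, Function.update c.store.mem a v.toNat⟩ := by
  ext i
  · rfl
  · by_cases h : i = a
    · subst h; simp [Config.store]
    · simp [Config.store, Function.update_of_ne h]

theorem Expr.eval_ne_zero_iff (hw : 0 < w) (c : Config k w E) (e : Expr k)
    (h : e.Fits w c.store.reg) : e.eval c.regs ≠ 0 ↔ e.nat c.store.reg ≠ 0 := by
  have : (e.eval c.regs).toNat = e.nat c.store.reg := Expr.toNat_eval hw c.regs e h
  rw [← this, not_iff_not, ← BitVec.toNat_inj]
  simp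

/-- The value 0 of `Prog.time` at loops and enumerator calls is harmless, since there the weakest
precondition is `False`. -/
theorem Runs.of_wp (hw : 0 < w) {p : Prog k} {s : Store k} {e : E.State} {Q : Store k → Prop}
    (h : p.wp w M Q s) : Runs E w M p s e p.time fun s' e' => Q s' ∧ e' = e := by
  induction p generalizing s Q with
  | skip => intro c hc he; exact ⟨_, c, .skip c, le_rfl, hc ▸ h, he⟩
  | assign r x =>
    rintro c rfl rfl
    refine ⟨_, _, .assign r x c, le_rfl, ?_, rfl⟩
    rw [Config.store_update_reg, Expr.toNat_eval hw _ _ h.1]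
    exact h.2
  | load r a =>
    rintro c rfl rfl
    have ha : (a.eval c.regs).toNat = a.nat c.store.reg := Expr.toNat_eval hw _ _ h.1
    refine ⟨_, _, .load r a c (ha ▸ h.2.1), le_rfl, ?_, rfl⟩
    rw [Config.store_update_reg, ha]
    exact h.2.2
  | store a v =>
    rintro c rfl rfl
    have ha : (a.eval c.regs).toNat = a.nat c.store.reg := Expr.toNat_eval hw _ _ h.1
    refine ⟨_, _, .store a v c (ha ▸ h.2.2.1), le_rfl, ?_, rfl⟩
    rw [Config.store_update_mem, ha, Expr.toNat_eval hw _ _ h.2.1]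
    exact h.2.2.2
  | seq p q ihp ihq =>
    refine Runs.seq (ihp h) ?_
    rintro s' e' ⟨hs, rfl⟩
    exact ihq hs
  | branch x p q ihp ihq =>
    rintro c rfl rfl
    obtain ⟨hf, h1, h2⟩ := h
    by_cases hx : x.nat c.store.reg = 0
    · obtain ⟨t, c', hx', ht, hq⟩ := ihq (h2 hx) c rfl rfl
      refine ⟨_, c', .branchFalse x p q c c' t ?_ hx', ?_, hq⟩
      · by_contra h0
        exact (Expr.eval_ne_zero_iff hw c x hf).1 h0 hx
      · simp only [Prog.time]; omega
    · obtain ⟨t, c', hx', ht, hq⟩ := ihp (h1 hx) c rfl rfl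
      refine ⟨_, c', .branchTrue x p q c c' t ((Expr.eval_ne_zero_iff hw c x hf).2 hx) hx', ?_, hq⟩
      simp only [Prog.time]; omega
  | loop | start | next => exact h.elim

theorem Runs.of_wp_le (hw : 0 < w) {p : Prog k} {s : Store k} {e : E.State} {T : ℕ}
    {Q : Store k → E.State → Prop} (hT : p.time ≤ T) (h : p.wp w M (fun s => Q s e) s) :
    Runs E w M p s e T Q :=
  (Runs.of_wp hw h).mono hT (by rintro s' e' ⟨hq, rfl⟩; exact hq)

/-- A loop with the invariant `I b`, where `b` is a bound on the remaining time. -/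
theorem Runs.loop (hw : 0 < w) {x : Expr k} {p : Prog k} (I : ℕ → Store k → E.State → Prop)
    {Q : Store k → E.State → Prop}
    (hf : ∀ b s e, I b s e → x.Fits w s.reg)
    (ht : ∀ b s e, I b s e → x.nat s.reg ≠ 0 →
      ∃ T b', x.cost + 1 + T + b' ≤ b ∧ Runs E w M p s e T (I b'))
    (hx : ∀ b s e, I b s e → x.nat s.reg = 0 → x.cost + 1 ≤ b ∧ Q s e)
    {b : ℕ} {s : Store k} {e : E.State} (h : I b s e) : Runs E w M (.loop x p) s e b Q := by
  -- Evaluating the guard costs at least one unit, so the remaining time strictly decreases and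
  -- proves termination.
  induction b using Nat.strong_induction_on generalizing s e with
  | _ b ih =>
    rintro c rfl rfl
    by_cases h0 : x.nat c.store.reg = 0
    · obtain ⟨hb, hq⟩ := hx _ _ _ h h0
      refine ⟨_, c, .loopFalse x p c ?_, hb, hq⟩
      by_contra h1
      exact (Expr.eval_ne_zero_iff hw c x (hf _ _ _ h)).1 h1 h0
    · obtain ⟨T, b', hb, hp⟩ := ht _ _ _ h h0
      obtain ⟨t, c', hx', ht', hI⟩ := hp c rfl rfl
      obtain ⟨t₂, c₂, hx₂, ht₂, hq⟩ := ih b' (by omega) hI c' rfl rfl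
      exact ⟨_, c₂, .loopTrue x p c c' c₂ t t₂
        ((Expr.eval_ne_zero_iff hw c x (hf _ _ _ h)).2 h0) hx' hx₂, by omega, hq⟩

theorem Runs.start {s : Store k} {e : E.State} :
    Runs E w M (.start : Prog k) s e (E.startCost e) fun s' e' => s' = s ∧ e' = E.start e := by
  rintro c rfl rfl
  exact ⟨_, _, .start c, le_rfl, rfl, rfl⟩

/-- A loop over all intervals that are delivered by the enumerator. -/
theorem Runs.enumerate (hw : 0 < w) {f a b : Fin k} {p : Prog k} {K : ℕ}
    (I : List (ℕ × ℕ) → Store k → Prop) {e : E.State} {l : List (ℕ × ℕ)} {c : ℕ}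
    (hy : E.Yields e l c) (hl : ∀ J ∈ l, J.1 < 2 ^ w ∧ J.2 < 2 ^ w) (hab : a ≠ b) (hfa : f ≠ a)
    (hfb : f ≠ b) {L₀ : List (ℕ × ℕ)}
    (hI : ∀ L s R, I L s → (∀ r, r ≠ f → r ≠ a → r ≠ b → R r = s.reg r) → I L ⟨R, s.mem⟩)
    (hp : ∀ L J L' s e, L₀ ++ l = L ++ J :: L' → I L s → s.reg a = J.1 → s.reg b = J.2 →
      Runs E w M p s e K fun s' e' => I (L ++ [J]) s' ∧ e' = e)
    {s : Store k} (hs : I L₀ s) :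
    Runs E w M (.seq (.next f a b) (.loop (.reg f) (.seq p (.next f a b)))) s e
      (c + (K + 1) * l.length + 1) fun s' _ => I (L₀ ++ l) s' := by
  have h1 : (1 : BitVec w).toNat = 1 := by
    have : 1 < 2 ^ w := Nat.one_lt_two_pow hw.ne'
    simp [Nat.mod_eq_of_lt this]
  induction hy generalizing s L₀ with
  | done e h =>
    rintro c rfl rfl
    refine ⟨_, _, .seq _ _ _ _ _ _ _ (.nextNone f a b c h) (.loopFalse _ _ _ ?_), ?_, ?_⟩
    · simp [Expr.eval]
    · simp [Expr.cost]
    · simp only [List.append_nil]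
      refine hI _ _ _ hs ?_
      intro r h1 h2 h3
      simp [Config.store, Function.update_of_ne h1]
  | more e J l c h hy' ih =>
    rintro x rfl rfl
    obtain ⟨i, j⟩ := J
    set x₁ : Config k w E := { x with
          regs := Function.update (Function.update (Function.update x.regs
            a (BitVec.ofNat w i)) b (BitVec.ofNat w j)) f 1
          enum := (E.next x.enum).2 } with hx₁
    have hn : Exec E w M (.next f a b) x _ x₁ := .nextSome f a b x i j h
    have hi : I L₀ x₁.store := by
      refine hI _ _ _ hs ?_
      intro r h1 h2 h3
      simp [hx₁, Config.store, Function.update_of_ne h1, Function.update_of_ne h2,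
        Function.update_of_ne h3]
    have hJ := hl (i, j) (by simp)
    obtain ⟨t, x₂, hx₂, ht, hI₂, he₂⟩ := hp L₀ (i, j) l x₁.store x₁.enum rfl hi
      (by simp [hx₁, Config.store, Function.update_of_ne hfa.symm, Function.update_of_ne hab,
            Nat.mod_eq_of_lt hJ.1])
      (by simp [hx₁, Config.store, Function.update_of_ne hfb.symm, Nat.mod_eq_of_lt hJ.2])
      x₁ rfl rfl
    obtain ⟨t', x₃, hx₃, ht', hq⟩ := ih (L₀ := L₀ ++ [(i, j)])
      (fun J hJ => hl J (List.mem_cons_of_mem _ hJ))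
      (fun L J L' s e h => hp L J L' s e (by simpa using h)) hI₂ x₂ rfl
      (he₂.trans (by simp [hx₁]))
    -- The induction hypothesis runs `next` and then the loop. Split this run, so that its `next`
    -- completes the body of the current iteration and its loop becomes the rest of the current
    -- loop.
    cases hx₃ with
    | seq _ _ _ y _ t₁ t₂ hy₁ hy₂ =>
    refine ⟨_, x₃, .seq _ _ _ _ _ _ _ hn (.loopTrue _ _ _ _ _ _ _ ?_
      (.seq _ _ _ _ _ _ _ hx₂ hy₁) hy₂), ?_, by simpa using hq⟩
    · intro h0
      have := congrArg BitVec.toNat h0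
      simp only [Expr.eval, hx₁, Function.update_self, h1] at this
      simp at this
    · simp only [Expr.cost, List.length_cons]
      rw [Nat.mul_add]
      omega

end Execution

/-! ### Ranks of strings among the suffixes -/

/-- The non-empty suffixes of `S`, from left to right. -/
def suffixes {σ : ℕ} (S : List (Fin σ)) : List (List (Fin σ)) :=
  (List.range' 1 S.length).map (suffixAt S)

/-- The number of suffixes that are smaller than `p`. -/
def lo {σ : ℕ} (S p : List (Fin σ)) : ℕ :=
  (suffixes S).countP fun t => decide (t < p)

open Classical in
/-- The number of suffixes that are smaller than `p` or have `p` as a prefix. -/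
noncomputable def hi {σ : ℕ} (S p : List (Fin σ)) : ℕ :=
  (suffixes S).countP fun t => decide (t < p ∨ p <+: t)

/-- The comparison is either decided within `p`, or `p` is matched completely and the remainders are
compared. -/
theorem lt_append_iff {α : Type*} [LinearOrder α] (t p x : List α) :
    t < p ++ x ↔ t < p ∨ ∃ y, t = p ++ y ∧ y < x := by
  induction p generalizing t with
  | nil => simp
  | cons a p ih =>
    cases t with
    | nil => simp
    | cons b t =>
      simp only [List.cons_append, List.cons_lt_cons_iff, ih, List.cons.injEq]
      constructor
      · rintro (h | ⟨rfl, h | ⟨y, rfl, h⟩⟩)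
        · exact .inl (.inl h)
        · exact .inl (.inr ⟨rfl, h⟩)
        · exact .inr ⟨y, ⟨rfl, rfl⟩, h⟩
      · rintro ((h | ⟨rfl, h⟩) | ⟨y, ⟨rfl, rfl⟩, h⟩)
        · exact .inl h
        · exact .inr ⟨rfl, .inl h⟩
        · exact .inr ⟨rfl, .inr ⟨y, rfl, h⟩⟩

/-- The right-hand side makes it evident that the condition is inherited by smaller strings, hence
by earlier entries of the suffix array. -/
theorem lt_or_prefix_iff {α : Type*} [LinearOrder α] (t p : List α) :
    t < p ∨ p <+: t ↔ ∃ x, t ≤ p ++ x := by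
  constructor
  · rintro (h | ⟨x, rfl⟩)
    · exact ⟨[], by simpa using h.le⟩
    · exact ⟨x, le_rfl⟩
  · rintro ⟨x, h⟩
    rcases h.lt_or_eq with h | rfl
    · rcases (lt_append_iff t p x).1 h with h | ⟨y, rfl, -⟩
      · exact .inl h
      · exact .inr ⟨y, rfl⟩
    · exact .inr ⟨x, rfl⟩

theorem not_lt_of_prefix {α : Type*} [LinearOrder α] {t p : List α} (h : p <+: t) : ¬ t < p := by
  obtain ⟨x, rfl⟩ := h
  have := (lt_append_iff (p ++ x) p x)
  intro h
  have h2 : p ≤ p ++ x := by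
    by_contra hc
    have hlt := not_le.1 hc
    clear this h hc
    induction p with
    | nil => simp at hlt
    | cons a p ih => exact ih (by simpa using hlt)
  exact absurd h (not_lt.2 h2)

/-- The elements that satisfy a downward closed property form an initial segment, and its length is
their number. -/
theorem getElem_iff_lt_countP {α : Type*} (P : α → Bool) (L : List α)
    (h : L.Pairwise fun a b => P b = true → P a = true) (r : ℕ) (hr : r < L.length) :
    P L[r] = true ↔ r < L.countP P := by
  induction L generalizing r with
  | nil => simp at hr
  | cons a L ih =>
    rw [List.pairwise_cons] at h
    by_cases ha : P a = true
    · rw [List.countP_cons_of_pos ha]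
      cases r with
      | zero => simp [ha]
      | succ r => simpa using ih h.2 r (by simpa using hr)
    · have h0 : ∀ b ∈ L, ¬ P b = true := fun b hb hp => ha (h.1 b hb hp)
      rw [List.countP_cons_of_neg ha, List.countP_eq_zero.2 h0]
      cases r with
      | zero => simp [ha]
      | succ r => simpa using h0 _ (List.getElem_mem (by simpa using hr))

/-! ### The suffixes with a given prefix are consecutive in the suffix array. -/

section Intervals
variable {σ : ℕ} (S : List (Fin σ))

theorem suffixArray_perm : (suffixArray S).Perm (List.range' 1 S.length) :=
  List.mergeSort_perm _ _

theorem length_suffixArray : (suffixArray S).length = S.length := by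
  simpa using (suffixArray_perm S).length_eq

theorem sorted_suffixArray :
    ((suffixArray S).map (suffixAt S)).Pairwise (· ≤ ·) := by
  rw [List.pairwise_map]
  have := List.pairwise_mergeSort
    (le := fun i j => decide (suffixAt S i ≤ suffixAt S j))
    (fun a b c hab hbc => by simpa using le_trans (by simpa using hab) (by simpa using hbc))
    (fun a b => by simpa using le_total (suffixAt S a) (suffixAt S b)) (List.range' 1 S.length)
  exact this.imp (by simp)

theorem countP_suffixArray (P : List (Fin σ) → Bool) :
    ((suffixArray S).map (suffixAt S)).countP P = (suffixes S).countP P :=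
  ((suffixArray_perm S).map _).countP_eq P

/-- The suffixes below `p` fill an initial segment of length `lo`. Together with those that start
with `p` they fill one of length `hi`. The difference is the interval of `p`, with ranks counted
from 0. -/
theorem prefix_suffixArray_iff (p : List (Fin σ)) (r : ℕ) (hr : r < (suffixArray S).length) :
    p <+: suffixAt S (suffixArray S)[r] ↔ lo S p ≤ r ∧ r < hi S p := by
  classical
  have hr' : r < ((suffixArray S).map (suffixAt S)).length := by simpa using hr
  have h1 := getElem_iff_lt_countP (fun t => decide (t < p)) _
    ((sorted_suffixArray S).imp fun {a b} hab h => by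
      simp only [decide_eq_true_eq] at h ⊢; exact lt_of_le_of_lt hab h) r hr'
  have h2 := getElem_iff_lt_countP (fun t => decide (t < p ∨ p <+: t)) _
    ((sorted_suffixArray S).imp fun {a b} hab h => by
      simp only [decide_eq_true_eq, lt_or_prefix_iff] at h ⊢
      exact h.imp fun x hx => hab.trans hx) r hr'
  rw [countP_suffixArray] at h1 h2
  simp only [List.getElem_map, decide_eq_true_eq] at h1 h2
  rw [lo, hi, ← not_lt, ← h1]
  have : (suffixes S).countP (fun t => decide (t < p ∨ p <+: t)) =
    (suffixes S).countP (fun t => decide (t < p ∨ p <+: t)) := rfl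
  rw [← h2]
  constructor
  · intro h; exact ⟨not_lt_of_prefix h, .inr h⟩
  · rintro ⟨h, h'⟩; exact h'.resolve_left h

theorem hi_le (p : List (Fin σ)) : hi S p ≤ S.length := by
  refine List.countP_le_length.trans ?_
  simp [suffixes]

theorem exists_suffix_of_infix {p : List (Fin σ)} (hp : p <:+: S) (hS : S ≠ []) :
    ∃ t ∈ suffixes S, p <+: t := by
  obtain ⟨a, b, rfl⟩ := hp
  -- The empty factor may be found at the very end of `S`, where no non-empty suffix begins; the
  -- whole text then serves instead.
  by_cases hpb : p ++ b = []
  · obtain ⟨rfl, rfl⟩ := List.append_eq_nil_iff.1 hpb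
    exact ⟨suffixAt _ 1, List.mem_map.2 ⟨1, by
      simp only [List.mem_range'_1]; have := List.length_pos_of_ne_nil hS; omega, rfl⟩,
      List.nil_prefix⟩
  · refine ⟨suffixAt _ (a.length + 1), List.mem_map.2 ⟨_, ?_, rfl⟩, ?_⟩
    · have := List.length_pos_of_ne_nil hpb
      simp only [List.mem_range'_1, List.length_append] at this ⊢
      omega
    · simp [suffixAt]

theorem lo_lt_hi {p : List (Fin σ)} (hp : p <:+: S) (hS : S ≠ []) : lo S p < hi S p := by
  obtain ⟨t, ht, hpt⟩ := exists_suffix_of_infix S hp hS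
  have ht' : t ∈ (suffixArray S).map (suffixAt S) := ((suffixArray_perm S).map _).mem_iff.2 ht
  obtain ⟨r, hr, rfl⟩ := List.getElem_of_mem ht'
  rw [List.getElem_map] at hpt
  have := (prefix_suffixArray_iff S p r (by simpa using hr)).1 hpt
  omega

/-- The suffix-array interval of a factor. -/
theorem isIntervalOf_iff {p : List (Fin σ)} (hp : p <:+: S) (hS : S ≠ []) (I : ℕ × ℕ) :
    IsIntervalOf S p I ↔ I = (lo S p + 1, hi S p) := by
  have h1 := lo_lt_hi S hp hS
  have h2 := hi_le S p
  have hl := length_suffixArray S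
  constructor
  · rintro ⟨ha, hb, hc, h⟩
    have key : ∀ r, r < S.length → ((lo S p ≤ r ∧ r < hi S p) ↔ I.1 ≤ r + 1 ∧ r + 1 ≤ I.2) := by
      intro r hr
      rw [← prefix_suffixArray_iff S p r (by omega)]
      exact h r (by omega)
    -- Two non-empty intervals with the same members coincide; testing the two ends of each
    -- suffices.
    have k1 := key (lo S p) (by omega)
    have k2 := key (hi S p - 1) (by omega)
    have k3 := key (I.1 - 1) (by omega)
    have k4 := key (I.2 - 1) (by omega)
    ext <;> simp only <;> omega
  · rintro rfl
    refine ⟨by simp, h1, h2, fun r hr => ?_⟩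
    rw [prefix_suffixArray_iff]
    simp only
    omega

theorem isInterval_iff (hS : S ≠ []) (I : ℕ × ℕ) :
    IsInterval S I ↔ ∃ p, p <:+: S ∧ I = (lo S p + 1, hi S p) := by
  refine exists_congr fun p => and_congr_right fun hp => isIntervalOf_iff S hp hS I

end Intervals

/-! ### The loci of the trie of a terminated text -/

section Trie
variable {σ : ℕ} (A : List (Fin (σ + 1)))

theorem mem_nextLetters {σ : ℕ} (S p : List (Fin σ)) (c : Fin σ) :
    c ∈ nextLetters S p ↔ (p ++ [c]) <:+: S := by
  simp [nextLetters]

theorem nextLetters_sorted {σ : ℕ} (S p : List (Fin σ)) :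
    (nextLetters S p).Pairwise (· < ·) :=
  (List.pairwise_lt_finRange σ).filter _

theorem mem_suffixes {σ : ℕ} {S t : List (Fin σ)} :
    t ∈ suffixes S ↔ t <:+ S ∧ t ≠ [] := by
  constructor
  · intro h
    obtain ⟨j, hj, rfl⟩ := List.mem_map.1 h
    refine ⟨List.drop_suffix _ _, ?_⟩
    simp only [List.mem_range'_1] at hj
    simp only [suffixAt, ne_eq, List.drop_eq_nil_iff]
    omega
  · rintro ⟨⟨a, rfl⟩, h0⟩
    refine List.mem_map.2 ⟨a.length + 1, ?_, by simp [suffixAt]⟩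
    have := List.length_pos_of_ne_nil h0
    simp only [List.mem_range'_1, List.length_append]
    omega

/-- The end marker occurs only as the last letter, so a factor that can be extended to the right
does not contain it. -/
theorem zero_notMem_of_append (hA : 0 ∉ A) {p : List (Fin (σ + 1))} {c : Fin (σ + 1)}
    (h : (p ++ [c]) <:+: A ++ [0]) : (0 : Fin (σ + 1)) ∉ p := by
  obtain ⟨a, b, h⟩ := h
  intro hp
  apply hA
  have h2 := congrArg List.dropLast h
  rw [List.dropLast_concat, show a ++ (p ++ [c]) ++ b = (a ++ p) ++ (c :: b) by simp,
    List.dropLast_append_of_ne_nil (by simp)] at h2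
  rw [← h2]
  simp [hp]

theorem zero_mem_of_mem_suffixes {t : List (Fin (σ + 1))} (h : t ∈ suffixes (A ++ [0])) :
    (0 : Fin (σ + 1)) ∈ t := by
  obtain ⟨⟨a, h⟩, h0⟩ := mem_suffixes.1 h
  have h1 := List.getLast_mem h0
  have h2 : t.getLast h0 = 0 := by
    have : (a ++ t).getLast (by simp [h0]) = t.getLast h0 := List.getLast_append_of_ne_nil _ h0
    rw [← this]; simp [h]
  rwa [h2] at h1

/-- A suffix with the prefix `p` continues with one of the letters that may follow `p`. -/
theorem exists_next_of_prefix {σ : ℕ} {S p t : List (Fin σ)} (ht : t ∈ suffixes S) (hp : p <+: t)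
    (h : p ≠ t) : ∃ c ∈ nextLetters S p, p ++ [c] <+: t := by
  obtain ⟨x, rfl⟩ := hp
  cases x with
  | nil => simp at h
  | cons c x =>
    have h2 : p ++ [c] <+: p ++ c :: x := ⟨x, by simp⟩
    exact ⟨c, (mem_nextLetters ..).2 (h2.isInfix.trans (mem_suffixes.1 ht).1.isInfix), h2⟩

/-- The blocks `(lo (p ++ [c]), hi (p ++ [c])]` for the letters `c` of the list are adjacent and
lead from `a` to `b`. -/
def Tiles {σ : ℕ} (S p : List (Fin σ)) : ℕ → List (Fin σ) → ℕ → Prop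
  | a, [], b => a = b
  | a, c :: cs, b => lo S (p ++ [c]) = a ∧ Tiles S p (hi S (p ++ [c])) cs b

/-- The string `p` itself is the only one below `p ++ [c]` that is neither below `p` nor a
continuation of `p` by a smaller letter. -/
theorem lt_append_singleton_iff {α : Type*} [LinearOrder α] {t p : List α} (h : t ≠ p) (c : α) :
    t < p ++ [c] ↔ t < p ∨ ∃ x < c, p ++ [x] <+: t := by
  rw [lt_append_iff]
  refine or_congr_right ⟨?_, ?_⟩
  · rintro ⟨y, rfl, hy⟩
    cases y with
    | nil => simp at h
    | cons x y =>
      rw [List.cons_lt_cons_iff] at hy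
      rcases hy with hy | hy
      · exact ⟨x, hy, y, by simp⟩
      · exact absurd hy.2 (by simp)
  · rintro ⟨x, hx, y, rfl⟩
    exact ⟨x :: y, by simp, List.cons_lt_cons_iff.2 (.inl hx)⟩

open Classical in
-- The predicate `D` collects the letters already passed; the count is the left boundary of the next
-- block. Since no suffix equals `p`, every suffix with prefix `p` falls into the block of its next
-- letter, and the blocks leave no gap.
theorem tiles_aux {σ : ℕ} {S p : List (Fin σ)} (hne : ∀ t ∈ suffixes S, t ≠ p)
    (cs : List (Fin σ)) (hcs : cs.Pairwise (· < ·)) (D : Fin σ → Prop)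
    (hD : ∀ x ∈ nextLetters S p, D x ∨ x ∈ cs) (hlt : ∀ x, D x → ∀ c ∈ cs, x < c) :
    Tiles S p ((suffixes S).countP fun t => decide (t < p ∨ ∃ x, D x ∧ p ++ [x] <+: t)) cs
      (hi S p) := by
  induction cs generalizing D with
  | nil =>
    refine List.countP_congr fun t ht => ?_
    simp only [decide_eq_true_eq]
    refine or_congr_right ⟨?_, ?_⟩
    · rintro ⟨x, -, h⟩
      exact (List.prefix_append _ _).trans h
    · intro h
      obtain ⟨c, hc, h'⟩ := exists_next_of_prefix ht h (hne t ht).symm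
      exact ⟨c, (hD c hc).resolve_right (by simp), h'⟩
  | cons c cs ih =>
    rw [List.pairwise_cons] at hcs
    have hltiff : ∀ t ∈ suffixes S,
        (t < p ++ [c] ↔ t < p ∨ ∃ x, D x ∧ p ++ [x] <+: t) := by
      intro t ht
      rw [lt_append_singleton_iff (hne t ht)]
      refine or_congr_right (exists_congr fun x => and_congr_left fun hx => ?_)
      have hx' : x ∈ nextLetters S p :=
        (mem_nextLetters ..).2 (hx.isInfix.trans (mem_suffixes.1 ht).1.isInfix)
      constructor
      · intro h
        rcases hD x hx' with h' | h'
        · exact h'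
        · rcases List.mem_cons.1 h' with rfl | h'
          · exact absurd h (lt_irrefl _)
          · exact absurd h (hcs.1 x h').asymm
      · intro h; exact hlt x h c (by simp)
    refine ⟨List.countP_congr fun t ht => ?_, ?_⟩
    · simpa only [decide_eq_true_eq] using hltiff t ht
    · have := ih hcs.2 (fun x => D x ∨ x = c) ?_ ?_
      · convert this using 1
        refine List.countP_congr fun t ht => ?_
        simp only [decide_eq_true_eq, hltiff t ht]
        constructor
        · rintro ((h | ⟨x, h, h'⟩) | h)
          · exact .inl h
          · exact .inr ⟨x, .inl h, h'⟩
          · exact .inr ⟨c, .inr rfl, h⟩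
        · rintro (h | ⟨x, h | rfl, h'⟩)
          · exact .inl (.inl h)
          · exact .inl (.inr ⟨x, h, h'⟩)
          · exact .inr h'
      · intro x hx
        rcases hD x hx with h | h
        · exact .inl (.inl h)
        · rcases List.mem_cons.1 h with rfl | h
          · exact .inl (.inr rfl)
          · exact .inr h
      · rintro x (h | rfl) d hd
        · exact hlt x h d (List.mem_cons_of_mem _ hd)
        · exact hcs.1 d hd

/-- All suffixes contain the end marker and an extensible locus does not, so no suffix ends at the
locus. For an unmarked text this fails: a suffix could end at an inner locus. -/
theorem tiles_nextLetters (hA : 0 ∉ A) {p : List (Fin (σ + 1))} (h : nextLetters (A ++ [0]) p ≠ []) :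
    Tiles (A ++ [0]) p (lo (A ++ [0]) p) (nextLetters (A ++ [0]) p) (hi (A ++ [0]) p) := by
  classical
  obtain ⟨c, hc⟩ := List.exists_mem_of_ne_nil _ h
  have h0 := zero_notMem_of_append A hA ((mem_nextLetters ..).1 hc)
  have := tiles_aux (S := A ++ [0]) (p := p)
    (fun t ht he => h0 (he ▸ zero_mem_of_mem_suffixes A ht)) _ (nextLetters_sorted _ _)
    (fun _ => False) (fun x hx => .inr hx) (by simp)
  convert this using 1
  refine List.countP_congr fun t ht => ?_
  simp

/-- `IsTrie S p t l`: below the locus `p`, the compacted trie is `t`, and the intervals of its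
nodes are `l`. -/
inductive IsTrie {σ : ℕ} (S : List (Fin σ)) : List (Fin σ) → OrdTree → List (ℕ × ℕ) → Prop
  | leaf (p : List (Fin σ)) (hp : p <:+: S) (h : nextLetters S p = []) :
      IsTrie S p (.node []) [(lo S p + 1, hi S p)]
  | unary (p : List (Fin σ)) (c : Fin σ) (t : OrdTree) (l : List (ℕ × ℕ)) (hp : p <:+: S)
      (h : nextLetters S p = [c]) (ht : IsTrie S (p ++ [c]) t l) : IsTrie S p t l
  | branch (p : List (Fin σ)) (c₁ c₂ : Fin σ) (cs : List (Fin σ)) (f : Fin σ → OrdTree)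
      (g : Fin σ → List (ℕ × ℕ)) (hp : p <:+: S) (h : nextLetters S p = c₁ :: c₂ :: cs)
      (ht : ∀ c ∈ nextLetters S p, IsTrie S (p ++ [c]) (f c) (g c)) :
      IsTrie S p (.node ((nextLetters S p).map f))
        ((lo S p + 1, hi S p) :: (nextLetters S p).flatMap g)

/-- The bound `|S| ≤ d + |p|` is preserved downwards, and once `d = 0` no extension of `p` fits into
`S`; so cutting off at depth `d` loses nothing. -/
theorem exists_isTrie {σ : ℕ} (S : List (Fin σ)) (d : ℕ) (p : List (Fin σ)) (hp : p <:+: S)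
    (hd : S.length ≤ d + p.length) : ∃ l, IsTrie S p (compactTrie S d p) l := by
  induction d generalizing p with
  | zero =>
    rw [compactTrie]
    refine ⟨_, .leaf p hp ?_⟩
    refine List.eq_nil_iff_forall_not_mem.2 fun c hc => ?_
    have := ((mem_nextLetters ..).1 hc).length_le
    simp at this
    omega
  | succ d ih =>
    have hc : ∀ c ∈ nextLetters S p, ∃ l, IsTrie S (p ++ [c]) (compactTrie S d (p ++ [c])) l := by
      intro c hc
      exact ih _ ((mem_nextLetters ..).1 hc) (by simp; omega)
    rw [compactTrie]
    split
    · next h => exact ⟨_, .leaf p hp h⟩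
    · next c h =>
      obtain ⟨l, hl⟩ := hc c (by simp [h])
      exact ⟨l, .unary p c _ l hp h hl⟩
    · next c₁ c₂ cs h =>
      have : ∀ c, ∃ l, c ∈ nextLetters S p →
          IsTrie S (p ++ [c]) (compactTrie S d (p ++ [c])) l := by
        intro c
        by_cases hm : c ∈ nextLetters S p
        · obtain ⟨l, hl⟩ := hc c hm; exact ⟨l, fun _ => hl⟩
        · exact ⟨[], fun h => absurd h hm⟩
      choose g hg using this
      rw [← h]
      exact ⟨_, .branch p c₁ c₂ cs _ g hp h hg⟩

theorem IsTrie.infix {σ : ℕ} {S p : List (Fin σ)} {t : OrdTree} {l : List (ℕ × ℕ)}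
    (h : IsTrie S p t l) : p <:+: S := by
  cases h <;> assumption

theorem Tiles.append {σ : ℕ} {S p : List (Fin σ)} {a b : ℕ} {cs : List (Fin σ)}
    (h : Tiles S p a cs b) (hpos : ∀ c ∈ cs, lo S (p ++ [c]) < hi S (p ++ [c])) :
    a ≤ b ∧ ∀ c ∈ cs, a ≤ lo S (p ++ [c]) ∧ hi S (p ++ [c]) ≤ b := by
  induction cs generalizing a with
  | nil => exact ⟨h.le, by simp⟩
  | cons c cs ih =>
    have h1 := ih h.2 fun d hd => hpos d (List.mem_cons_of_mem _ hd)
    have h2 := hpos c (by simp)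
    have h3 := h.1
    refine ⟨by omega, fun d hd => ?_⟩
    rcases List.mem_cons.1 hd with rfl | hd
    · omega
    · have := h1.2 d hd
      omega

/-- The intervals of the nodes below `p` lie in the interval of `p`. -/
theorem IsTrie.bounds {p : List (Fin (σ + 1))} {t : OrdTree} {l : List (ℕ × ℕ)}
    (hA : 0 ∉ A) (h : IsTrie (A ++ [0]) p t l) :
    ∀ I ∈ l, lo (A ++ [0]) p < I.1 ∧ I.1 ≤ I.2 ∧ I.2 ≤ hi (A ++ [0]) p := by
  have hS : A ++ [0] ≠ [] := by simp
  induction h with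
  | leaf p hp h =>
    have := lo_lt_hi _ hp hS
    simp; omega
  | unary p c t l hp h ht ih =>
    -- A single tile fills everything: `p` and `p ++ [c]` have the same interval.
    have h1 := tiles_nextLetters A hA (p := p) (by simp [h])
    rw [h] at h1
    simp only [Tiles] at h1
    rw [← h1.1, ← h1.2]
    exact ih
  | branch p c₁ c₂ cs f g hp h ht ih =>
    intro I hI
    have h0 := lo_lt_hi _ hp hS
    have h1 := (tiles_nextLetters A hA (p := p) (by simp [h])).append
      fun c hc => lo_lt_hi _ (ht c hc).infix hS
    rcases List.mem_cons.1 hI with rfl | hI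
    · simp; omega
    · obtain ⟨c, hc, hI⟩ := List.mem_flatMap.1 hI
      have := ih c hc I hI
      have := h1.2 c hc
      omega

theorem Tiles.nodup {σ : ℕ} {S p : List (Fin σ)} {a b : ℕ} {cs : List (Fin σ)}
    (h : Tiles S p a cs b) (hpos : ∀ c ∈ cs, lo S (p ++ [c]) < hi S (p ++ [c]))
    (g : Fin σ → List (ℕ × ℕ)) (hg : ∀ c ∈ cs, (g c).Nodup)
    (hb : ∀ c ∈ cs, ∀ I ∈ g c, lo S (p ++ [c]) < I.1 ∧ I.1 ≤ I.2 ∧ I.2 ≤ hi S (p ++ [c])) :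
    (cs.flatMap g).Nodup := by
  induction cs generalizing a with
  | nil => simp
  | cons c cs ih =>
    have hpos' := fun d hd => hpos d (List.mem_cons_of_mem _ hd)
    rw [List.flatMap_cons, List.nodup_append]
    refine ⟨hg c (by simp), ih h.2 hpos' (fun d hd => hg d (List.mem_cons_of_mem _ hd))
      fun d hd => hb d (List.mem_cons_of_mem _ hd), ?_⟩
    rintro I hI J hJ rfl
    obtain ⟨d, hd, hJ⟩ := List.mem_flatMap.1 hJ
    have h1 := hb c (by simp) I hI
    have h2 := hb d (List.mem_cons_of_mem _ hd) I hJ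
    have h3 := (h.2.append hpos').2 d hd
    omega

theorem Tiles.length {σ : ℕ} {S p : List (Fin σ)} {a b : ℕ} {cs : List (Fin σ)}
    (h : Tiles S p a cs b) (g : Fin σ → List (ℕ × ℕ))
    (hg : ∀ c ∈ cs, (g c).length + 1 + 2 * lo S (p ++ [c]) ≤ 2 * hi S (p ++ [c])) :
    (cs.flatMap g).length + cs.length + 2 * a ≤ 2 * b := by
  induction cs generalizing a with
  | nil => obtain rfl : a = b := h; simp
  | cons c cs ih =>
    have h1 := ih h.2 fun d hd => hg d (List.mem_cons_of_mem _ hd)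
    have h2 := hg c (by simp)
    have h3 := h.1
    simp only [List.flatMap_cons, List.length_append, List.length_cons]
    omega

/-- Different children have disjoint blocks of ranks. A branching node has at least two non-empty
blocks, so its own interval is strictly larger than each of them and cannot recur below it. -/
theorem IsTrie.nodup {p : List (Fin (σ + 1))} {t : OrdTree} {l : List (ℕ × ℕ)}
    (hA : 0 ∉ A) (h : IsTrie (A ++ [0]) p t l) : l.Nodup := by
  have hS : A ++ [0] ≠ [] := by simp
  induction h with
  | leaf p hp h => simp
  | unary p c t l hp h ht ih => exact ih
  | branch p c₁ c₂ cs f g hp h ht ih =>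
    have hpos : ∀ c ∈ nextLetters (A ++ [0]) p, lo (A ++ [0]) (p ++ [c]) < hi (A ++ [0]) (p ++ [c]) :=
      fun c hc => lo_lt_hi _ (ht c hc).infix hS
    have hT := tiles_nextLetters A hA (p := p) (by simp [h])
    have hb := fun c hc => (ht c hc).bounds A hA
    rw [List.nodup_cons]
    refine ⟨fun hI => ?_, hT.nodup hpos g ih hb⟩
    obtain ⟨c, hc, hI⟩ := List.mem_flatMap.1 hI
    have h1 := hb c hc _ hI
    rw [h] at hT hc hpos
    have h2 := hpos c₁ (by simp)
    have h3 := hpos c₂ (by simp)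
    have h4 := hT.2.append fun d hd => hpos d (List.mem_cons_of_mem _ hd)
    have h5 := hT.1
    have h6 := hT.2.1
    have h7 := h4.2 c₂ (by simp)
    rcases List.mem_cons.1 hc with rfl | hc
    · simp only at h1; omega
    · have := h4.2 c hc
      simp only at h1; omega

/-- This is the bound 2m - 1 for the number of nodes over m ranks, written without subtraction. Each
child of a branching node contributes one spare unit; of at least two such units, one pays for the
node and one restores the invariant. -/
theorem IsTrie.length {p : List (Fin (σ + 1))} {t : OrdTree} {l : List (ℕ × ℕ)}
    (hA : 0 ∉ A) (h : IsTrie (A ++ [0]) p t l) :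
    l.length + 1 + 2 * lo (A ++ [0]) p ≤ 2 * hi (A ++ [0]) p := by
  have hS : A ++ [0] ≠ [] := by simp
  induction h with
  | leaf p hp h =>
    have := lo_lt_hi _ hp hS
    simp; omega
  | unary p c t l hp h ht ih =>
    have h1 := tiles_nextLetters A hA (p := p) (by simp [h])
    rw [h] at h1
    simp only [Tiles] at h1
    rw [← h1.1, ← h1.2]
    exact ih
  | branch p c₁ c₂ cs f g hp h ht ih =>
    have hT := (tiles_nextLetters A hA (p := p) (by simp [h])).length g ih
    have h2 : 2 ≤ (nextLetters (A ++ [0]) p).length := by simp [h]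
    simp only [List.length_cons]
    omega

/-- Contraction loses no interval: a locus with one outgoing letter has the interval of its
successor. -/
theorem IsTrie.mem_iff {p : List (Fin (σ + 1))} {t : OrdTree} {l : List (ℕ × ℕ)}
    (hA : 0 ∉ A) (h : IsTrie (A ++ [0]) p t l) (I : ℕ × ℕ) :
    I ∈ l ↔ ∃ q, p <+: q ∧ q <:+: A ++ [0] ∧ I = (lo (A ++ [0]) q + 1, hi (A ++ [0]) q) := by
  have step : ∀ {p q : List (Fin (σ + 1))}, p <+: q → q <:+: A ++ [0] → q ≠ p →
      ∃ c ∈ nextLetters (A ++ [0]) p, p ++ [c] <+: q := by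
    rintro p _ ⟨x, rfl⟩ hq hne
    cases x with
    | nil => simp at hne
    | cons c x =>
      have h2 : p ++ [c] <+: p ++ c :: x := ⟨x, by simp⟩
      exact ⟨c, (mem_nextLetters ..).2 (h2.isInfix.trans hq), h2⟩
  induction h with
  | leaf p hp h =>
    rw [List.mem_singleton]
    constructor
    · rintro rfl; exact ⟨p, List.prefix_rfl, hp, rfl⟩
    · rintro ⟨q, hpq, hq, rfl⟩
      by_cases hne : q = p
      · rw [hne]
      · obtain ⟨c, hc, -⟩ := step hpq hq hne
        simp [h] at hc
  | unary p c t l hp h ht ih =>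
    have h1 := tiles_nextLetters A hA (p := p) (by simp [h])
    rw [h] at h1
    simp only [Tiles] at h1
    refine ih.trans ⟨?_, ?_⟩
    · rintro ⟨q, hpq, hq⟩
      exact ⟨q, (List.prefix_append _ _).trans hpq, hq⟩
    · rintro ⟨q, hpq, hq, rfl⟩
      by_cases hne : q = p
      · exact ⟨p ++ [c], List.prefix_rfl, ht.infix, by rw [hne, h1.1, h1.2]⟩
      · obtain ⟨d, hd, hd'⟩ := step hpq hq hne
        rw [h, List.mem_singleton] at hd
        exact ⟨q, hd ▸ hd', hq, rfl⟩
  | branch p c₁ c₂ cs f g hp h ht ih =>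
    rw [List.mem_cons, List.mem_flatMap]
    constructor
    · rintro (rfl | ⟨c, hc, hI⟩)
      · exact ⟨p, List.prefix_rfl, hp, rfl⟩
      · obtain ⟨q, hpq, hq⟩ := (ih c hc).1 hI
        exact ⟨q, (List.prefix_append _ _).trans hpq, hq⟩
    · rintro ⟨q, hpq, hq, rfl⟩
      by_cases hne : q = p
      · rw [hne]; exact .inl rfl
      · obtain ⟨d, hd, hd'⟩ := step hpq hq hne
        exact .inr ⟨d, hd, (ih d hd).2 ⟨q, hd', hq, rfl⟩⟩

end Trie

/-! ### Parentheses at the boundaries of intervals -/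

/-- For every `r` with `a ≤ r < a + m`, `f r` opening and `g r` closing parentheses. -/
def parens (f g : ℕ → ℕ) (a m : ℕ) : List Bool :=
  (List.range' a m).flatMap fun r => List.replicate (f r) true ++ List.replicate (g r) false

/-- The parentheses of the intervals of `l` at the positions `a, …, a + m - 1`. -/
def boundaries (l : List (ℕ × ℕ)) (a m : ℕ) : List Bool :=
  parens (fun r => l.countP fun I => I.1 == r + 1) (fun r => l.countP fun I => I.2 == r + 1) a m

theorem parens_congr {f g f' g' : ℕ → ℕ} {a m : ℕ} (hf : ∀ r, a ≤ r → r < a + m → f r = f' r)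
    (hg : ∀ r, a ≤ r → r < a + m → g r = g' r) : parens f g a m = parens f' g' a m := by
  refine List.flatMap_congr fun r hr => ?_
  rw [List.mem_range'_1] at hr
  rw [hf r hr.1 hr.2, hg r hr.1 hr.2]

theorem parens_add (f g : ℕ → ℕ) (a m m' : ℕ) :
    parens f g a (m + m') = parens f g a m ++ parens f g (a + m) m' := by
  rw [parens, ← List.range'_append_1, List.flatMap_append]; rfl

/-- At each position the opening parentheses precede the closing ones, so an additional one at the
first position becomes the first symbol. In the same way an additional closing one at the last
position becomes the last symbol. -/
theorem parens_open {f f' g : ℕ → ℕ} {a m : ℕ} (h0 : f' a = f a + 1)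
    (h : ∀ r, r ≠ a → f' r = f r) : parens f' g a (m + 1) = true :: parens f g a (m + 1) := by
  have : parens f' g (a + 1) m = parens f g (a + 1) m :=
    parens_congr (fun r hr _ => h r (by omega)) fun _ _ _ => rfl
  rw [add_comm m 1, parens_add, parens_add, this]
  simp [parens, h0, List.replicate_succ]

theorem parens_close {f g g' : ℕ → ℕ} {a m : ℕ} (h0 : g' (a + m) = g (a + m) + 1)
    (h : ∀ r, r ≠ a + m → g' r = g r) : parens f g' a (m + 1) = parens f g a (m + 1) ++ [false] := by
  have : parens f g' a m = parens f g a m :=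
    parens_congr (fun _ _ _ => rfl) fun r _ hr => h r (by omega)
  rw [parens_add, parens_add, this]
  simp [parens, h0, List.replicate_succ']

/-- The positions `a, …, b - 1` stand for the ranks `a + 1, …, b`; an interval of all these ranks
wraps a pair of parentheses around the rest. -/
theorem boundaries_cons (l : List (ℕ × ℕ)) (a b : ℕ) (h : a < b) :
    boundaries ((a + 1, b) :: l) a (b - a) = true :: boundaries l a (b - a) ++ [false] := by
  obtain ⟨m, rfl⟩ : ∃ m, b = a + m + 1 := ⟨b - a - 1, by omega⟩
  rw [show a + m + 1 - a = m + 1 by omega, boundaries, boundaries,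
    parens_open (f := fun r => l.countP fun I => I.1 == r + 1),
    parens_close (g := fun r => l.countP fun I => I.2 == r + 1)]
  · simp
  · simp
  · intro r hr
    rw [List.countP_cons_of_neg]
    simp; omega
  · simp
  · intro r hr
    rw [List.countP_cons_of_neg]
    simp; omega

theorem boundaries_append (l l' : List (ℕ × ℕ)) (a m : ℕ)
    (h : ∀ I ∈ l', (I.1 ≤ a ∨ a + m < I.1) ∧ (I.2 ≤ a ∨ a + m < I.2)) :
    boundaries (l ++ l') a m = boundaries l a m := by
  refine parens_congr (fun r h1 h2 => ?_) fun r h1 h2 => ?_ <;>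
  · rw [List.countP_append, Nat.add_eq_left, List.countP_eq_zero]
    intro I hI
    have := h I hI
    simp only [beq_iff_eq]
    omega

theorem boundaries_append' (l l' : List (ℕ × ℕ)) (a m : ℕ)
    (h : ∀ I ∈ l, (I.1 ≤ a ∨ a + m < I.1) ∧ (I.2 ≤ a ∨ a + m < I.2)) :
    boundaries (l ++ l') a m = boundaries l' a m := by
  refine parens_congr (fun r h1 h2 => ?_) fun r h1 h2 => ?_ <;>
  · rw [List.countP_append, Nat.add_eq_right, List.countP_eq_zero]
    intro I hI
    have := h I hI
    simp only [beq_iff_eq]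
    omega

/-- After a cut at the block boundaries, each piece sees the endpoints of its own block only. -/
theorem Tiles.boundaries {σ : ℕ} {S p : List (Fin σ)} {a b : ℕ} {cs : List (Fin σ)}
    (h : Tiles S p a cs b) (hpos : ∀ c ∈ cs, lo S (p ++ [c]) < hi S (p ++ [c]))
    (g : Fin σ → List (ℕ × ℕ))
    (hb : ∀ c ∈ cs, ∀ I ∈ g c, lo S (p ++ [c]) < I.1 ∧ I.1 ≤ I.2 ∧ I.2 ≤ hi S (p ++ [c])) :
    TreeTopology.boundaries (cs.flatMap g) a (b - a) = cs.flatMap fun c =>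
      TreeTopology.boundaries (g c) (lo S (p ++ [c])) (hi S (p ++ [c]) - lo S (p ++ [c])) := by
  induction cs generalizing a with
  | nil => obtain rfl : a = b := h; simp [TreeTopology.boundaries, parens]
  | cons c cs ih =>
    have hpos' := fun d hd => hpos d (List.mem_cons_of_mem _ hd)
    have h1 := hpos c (by simp)
    have h2 := h.2.append hpos'
    have h3 := h.1
    rw [List.flatMap_cons, List.flatMap_cons, ← ih h.2 hpos' fun d hd => hb d (List.mem_cons_of_mem _ hd),
      show b - a = (hi S (p ++ [c]) - lo S (p ++ [c])) + (b - hi S (p ++ [c])) by omega]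
    rw [TreeTopology.boundaries, parens_add, ← TreeTopology.boundaries, ← TreeTopology.boundaries,
      boundaries_append, boundaries_append', h3,
      show a + (hi S (p ++ [c]) - a) = hi S (p ++ [c]) by omega]
    · intro I hI
      have := hb c (by simp) I hI
      omega
    · intro I hI
      obtain ⟨d, hd, hI⟩ := List.mem_flatMap.1 hI
      have := hb d (List.mem_cons_of_mem _ hd) I hI
      have := h2.2 d hd
      omega

/-- Both sides obey the same recursion: the node wraps one pair of parentheses around the
concatenated sequences of its children. -/
theorem IsTrie.bp {σ : ℕ} (A : List (Fin (σ + 1))) {p : List (Fin (σ + 1))} {t : OrdTree}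
    {l : List (ℕ × ℕ)} (hA : 0 ∉ A) (h : IsTrie (A ++ [0]) p t l) :
    t.bp = boundaries l (lo (A ++ [0]) p) (hi (A ++ [0]) p - lo (A ++ [0]) p) := by
  have hS : A ++ [0] ≠ [] := by simp
  induction h with
  | leaf p hp h =>
    rw [boundaries_cons _ _ _ (lo_lt_hi _ hp hS)]
    simp [OrdTree.bp, boundaries, parens]
  | unary p c t l hp h ht ih =>
    have h1 := tiles_nextLetters A hA (p := p) (by simp [h])
    rw [h] at h1
    simp only [Tiles] at h1
    rw [← h1.1, ← h1.2]
    exact ih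
  | branch p c₁ c₂ cs f g hp h ht ih =>
    rw [boundaries_cons _ _ _ (lo_lt_hi _ hp hS),
      (tiles_nextLetters A hA (p := p) (by simp [h])).boundaries
        (fun c hc => lo_lt_hi _ (ht c hc).infix hS) g fun c hc => (ht c hc).bounds A hA,
      OrdTree.bp, List.flatMap_map]
    congr 2
    exact List.flatMap_congr fun c hc => ih c hc

theorem IsTrie.length_bp {σ : ℕ} {S p : List (Fin σ)} {t : OrdTree} {l : List (ℕ × ℕ)}
    (h : IsTrie S p t l) : t.bp.length = 2 * l.length := by
  induction h with
  | leaf p hp h => simp [OrdTree.bp]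
  | unary p c t l hp h ht ih => exact ih
  | branch p c₁ c₂ cs f g hp h ht ih =>
    have : ∀ L : List (Fin σ), (∀ c ∈ L, (f c).bp.length = 2 * (g c).length) →
        (L.flatMap fun c => (f c).bp).length = 2 * (L.flatMap g).length := by
      intro L hL
      induction L with
      | nil => rfl
      | cons c L ihL =>
        rw [List.flatMap_cons, List.flatMap_cons, List.length_append, List.length_append,
          ihL fun d hd => hL d (List.mem_cons_of_mem _ hd), hL c (by simp)]
        omega
    rw [OrdTree.bp, List.flatMap_map]
    simp only [List.length_append, List.length_cons, List.length_nil, this _ ih]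
    omega

theorem boundaries_perm {l l' : List (ℕ × ℕ)} (h : l.Perm l') (a m : ℕ) :
    boundaries l a m = boundaries l' a m :=
  parens_congr (fun _ _ _ => h.countP_eq _) fun _ _ _ => h.countP_eq _

/-- The parentheses of the suffix tree are the boundaries of the suffix-array intervals. -/
theorem bp_suffixTree {σ : ℕ} (T : List (Fin σ)) {l : List (ℕ × ℕ)} (hl : l.Nodup)
    (hm : ∀ I, I ∈ l ↔ IsInterval (terminated T) I) :
    (suffixTree T).bp = boundaries l 0 (T.length + 1) ∧
      (suffixTree T).bp.length = 2 * l.length ∧ l.length ≤ 2 * T.length + 1 ∧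
      ∀ I ∈ l, 1 ≤ I.1 ∧ I.1 ≤ I.2 ∧ I.2 ≤ T.length + 1 := by
  classical
  have hA : (0 : Fin (σ + 1)) ∉ T.map Fin.succ := by simp [Fin.succ_ne_zero]
  have hS : T.map Fin.succ ++ [0] ≠ [] := by simp
  obtain ⟨l', h⟩ := exists_isTrie (terminated T) (terminated T).length [] List.nil_infix (by simp)
  have hlo : lo (T.map Fin.succ ++ [0]) [] = 0 := by simp [lo]
  have hhi : hi (T.map Fin.succ ++ [0]) [] = T.length + 1 := by
    simp [hi, suffixes]
  -- The delivered list and the list of node intervals have the same members and no repetitions, so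
  -- they differ only in order, which the counts ignore.
  have hp : l.Perm l' := by
    refine (List.perm_ext_iff_of_nodup hl (h.nodup _ hA)).2 fun I => ?_
    rw [hm, IsTrie.mem_iff _ hA h, terminated, isInterval_iff _ hS]
    simp
  have h1 := IsTrie.bp _ hA h
  have h2 := IsTrie.length _ hA h
  have h3 := IsTrie.bounds _ hA h
  rw [hlo, hhi] at h1 h2 h3
  refine ⟨?_, ?_, ?_, fun I hI => ?_⟩
  · rw [suffixTree, h1, boundaries_perm hp]; rfl
  · rw [suffixTree, h.length_bp, hp.length_eq]
  · rw [hp.length_eq]; omega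
  · have := h3 I (hp.mem_iff.1 hI)
    omega

/-! ### Packed unary counters -/

/-- `c` one bits below the binary representation of `x`. -/
def ones : ℕ → ℕ → ℕ
  | 0, x => x
  | c + 1, x => 2 * ones c x + 1

/-- The counters of a list in unary representation, separated by zero bits, with a final one bit;
the first counter occupies the lowest bits. -/
def enc : List ℕ → ℕ
  | [] => 1
  | c :: v => ones c (2 * enc v)

/-- Insertion of a one bit below the `k`-th zero bit of `x`. -/
def ins (x k : ℕ) : ℕ :=
  match k with
  | 0 => 2 * x + 1
  | k + 1 => if x % 2 = 1 then 2 * ins (x / 2) (k + 1) + 1 else 2 * ins (x / 2) k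
termination_by x + k
decreasing_by all_goals omega

theorem ins_zero (x : ℕ) : ins x 0 = 2 * x + 1 := by rw [ins]

theorem ins_odd (x k : ℕ) (hk : k ≠ 0) (hx : x % 2 ≠ 0) : ins x k = 2 * ins (x / 2) k + 1 := by
  obtain ⟨k, rfl⟩ := Nat.exists_eq_succ_of_ne_zero hk
  rw [ins, if_pos (by omega)]

theorem ins_even (x k : ℕ) (hk : k ≠ 0) (hx : x % 2 = 0) : ins x k = 2 * ins (x / 2) (k - 1) := by
  obtain ⟨k, rfl⟩ := Nat.exists_eq_succ_of_ne_zero hk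
  rw [ins, if_neg (by omega)]
  rfl

theorem enc_zero_cons (v : List ℕ) : enc (0 :: v) = 2 * enc v := rfl

theorem enc_succ_cons (c : ℕ) (v : List ℕ) : enc ((c + 1) :: v) = 2 * enc (c :: v) + 1 := rfl

theorem enc_replicate (h : ℕ) : enc (List.replicate h 0) = 2 ^ h := by
  induction h with
  | zero => rfl
  | succ h ih => rw [List.replicate_succ, enc_zero_cons, ih, pow_succ']

/-- The `k`-th zero bit ends the unary representation of the `k`-th counter, so a one bit inserted
below it lengthens just this counter. -/
theorem ins_enc (v : List ℕ) (k : ℕ) (hk : k < v.length) :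
    ins (enc v) k = enc (v.modify k (· + 1)) := by
  induction v generalizing k with
  | nil => simp at hk
  | cons c v ih =>
    cases k with
    | zero => rw [ins_zero]; rfl
    | succ k =>
      simp only [List.modify_succ_cons]
      have hk' : k < v.length := by simpa using hk
      induction c with
      | zero =>
        rw [enc_zero_cons, enc_zero_cons, ins_even _ _ (by omega) (by omega), ← ih k hk']
        simp
      | succ c ihc =>
        rw [enc_succ_cons, enc_succ_cons, ins_odd _ _ (by omega) (by omega), ← ihc (by simpa using hk)]
        congr 3; omega

/-- There is one zero per counter, one one bit per unit, and the final one on top. Hence the size of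
the code reveals the sum of the counters, and one comparison detects a full chunk. -/
theorem enc_bounds (v : List ℕ) :
    2 ^ (v.length + v.sum) ≤ enc v ∧ enc v < 2 ^ (v.length + v.sum + 1) := by
  induction v with
  | nil => simp [enc]
  | cons c v ih =>
    induction c with
    | zero =>
      simp only [enc_zero_cons, List.length_cons, List.sum_cons, zero_add]
      rw [show v.length + 1 + v.sum = v.length + v.sum + 1 by omega]
      rw [pow_succ, pow_succ] at *
      omega
    | succ c ihc =>
      simp only [enc_succ_cons, List.length_cons, List.sum_cons] at ihc ⊢
      rw [show v.length + 1 + (c + 1 + v.sum) = v.length + 1 + (c + v.sum) + 1 by omega]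
      rw [pow_succ, pow_succ] at *
      omega

theorem enc_eq_one_iff (v : List ℕ) : enc v ≤ 1 ↔ v = [] := by
  constructor
  · intro h
    cases v with
    | nil => rfl
    | cons c v =>
      have h1 := (enc_bounds (c :: v)).1
      have : 2 ^ 1 ≤ 2 ^ ((c :: v).length + (c :: v).sum) :=
        Nat.pow_le_pow_right (by omega) (by simp; omega)
      omega
  · rintro rfl; rfl

/-- Above its `m` bits `x` has only zeros, so the insertion point is at most `k` places higher. Here
`x` need not be a code, because the table is filled for every `x < 4 ^ h`. -/
theorem ins_lt (m x k : ℕ) (h : x < 2 ^ m) : ins x k < 2 ^ (m + k + 1) := by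
  induction x, k using ins.induct generalizing m with
  | case1 x =>
    rw [ins_zero, add_zero, pow_succ]; omega
  | case2 x k hx ih =>
    cases m with
    | zero => simp at h; omega
    | succ m =>
      rw [ins_odd _ _ (by omega) (by omega)]
      have := ih m (by rw [pow_succ] at h; omega)
      rw [Nat.succ_eq_add_one, show m + 1 + (k + 1) + 1 = m + (k + 1) + 1 + 1 by omega, pow_succ]
      omega
  | case3 x k hx ih =>
    rw [ins_even _ _ (by omega) (by omega), Nat.succ_sub_one, Nat.succ_eq_add_one]
    have : ins (x / 2) k < 2 ^ (m + k + 1) := by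
      cases m with
      | zero => exact ih 0 (by simp at h ⊢; omega)
      | succ m =>
        refine (ih m (by rw [pow_succ] at h; omega)).trans_le ?_
        exact Nat.pow_le_pow_right (by omega) (by omega)
    rw [show m + (k + 1) + 1 = m + k + 1 + 1 by omega, pow_succ]
    omega

theorem sum_modify (v : List ℕ) (k : ℕ) (hk : k < v.length) :
    (v.modify k (· + 1)).sum = v.sum + 1 := by
  induction v generalizing k with
  | nil => simp at hk
  | cons c v ih =>
    cases k with
    | zero => simp; omega
    | succ k => simp [ih k (by simpa using hk)]; omega

theorem getD_modify (v : List ℕ) (k i : ℕ) (hk : k < v.length) :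
    (v.modify k (· + 1)).getD i 0 = v.getD i 0 + if i = k then 1 else 0 := by
  induction v generalizing k i with
  | nil => simp at hk
  | cons c v ih =>
    cases k with
    | zero => cases i <;> simp
    | succ k =>
      cases i with
      | zero => simp
      | succ i => simpa using ih k i (by simpa using hk)

/-- A linked list in the cells `p, …, f - 1` that starts at `a` and whose records hold the
counters in `vs`. -/
def Chain (mem : ℕ → ℕ) (p f : ℕ) : ℕ → List (List ℕ) → Prop
  | a, [] => a = 0
  | a, v :: vs => p ≤ a ∧ a + 2 ≤ f ∧ a ≠ 0 ∧ mem a = enc v ∧ Chain mem p f (mem (a + 1)) vs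

theorem Chain.mono {mem mem' : ℕ → ℕ} {p p' f f' a : ℕ} {vs : List (List ℕ)}
    (h : Chain mem p f a vs) (hp : p' ≤ p) (hf : f ≤ f')
    (hm : ∀ i, p ≤ i → i < f → mem' i = mem i) : Chain mem' p' f' a vs := by
  induction vs generalizing a with
  | nil => exact h
  | cons v vs ih =>
    obtain ⟨h1, h2, h3, h4, h5⟩ := h
    refine ⟨by omega, by omega, h3, ?_, ?_⟩
    · rw [hm a h1 (by omega), h4]
    · rw [hm (a + 1) (by omega) (by omega)]; exact ih h5

/-! ### The program -/

local infixl:65 "+ₑ" => Expr.bin BinOp.add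
local infixl:65 "-ₑ" => Expr.bin BinOp.sub
local infixl:70 "*ₑ" => Expr.bin BinOp.mul
local infixl:70 "/ₑ" => Expr.bin BinOp.div
local infixl:70 "%ₑ" => Expr.bin BinOp.mod
local infixl:60 "<ₑ" => Expr.bin BinOp.lt
local infixl:75 "≪ₑ" => Expr.bin BinOp.shl
local infixr:50 ";;" => Prog.seq

/-- Compute the number `h` of counters in a word and `4 ^ h`. -/
def chooseSize : Prog 19 :=
  .assign 2 (.const 1) ;; .assign 3 (.const 4) ;;
  .loop (.reg 3 *ₑ .reg 3 <ₑ .reg 0)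
    (.assign 2 (.reg 2 +ₑ .const 1) ;; .assign 3 (.const 4 *ₑ .reg 3))

/-- Compute one entry of the table of `ins`. -/
def fillEntry : Prog 19 :=
  .assign 12 (.reg 11 /ₑ .reg 2) ;; .assign 13 (.reg 11 %ₑ .reg 2) ;;
  .branch (.reg 13)
    (.branch (.reg 12 %ₑ .const 2)
      (.load 14 ((.reg 12 /ₑ .const 2) *ₑ .reg 2 +ₑ .reg 13) ;;
        .assign 14 (.const 2 *ₑ .reg 14 +ₑ .const 1))
      (.load 14 ((.reg 12 /ₑ .const 2) *ₑ .reg 2 +ₑ (.reg 13 -ₑ .const 1)) ;;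
        .assign 14 (.const 2 *ₑ .reg 14)))
    (.assign 14 (.const 2 *ₑ .reg 12 +ₑ .const 1)) ;;
  .store (.reg 11) (.reg 14) ;; .assign 11 (.reg 11 +ₑ .const 1)

/-- Compute the table of `ins`. -/
def fillTable : Prog 19 :=
  (.assign 17 (.reg 3 *ₑ .reg 2) ;; .assign 7 (.const 1 ≪ₑ .reg 2) ;; .assign 11 (.const 0)) ;;
  .loop (.reg 11 <ₑ .reg 17) fillEntry

/-- Clear the cells for the counters of one chunk. -/
def clearCounters : Prog 19 :=
  (.assign 4 (.reg 17 +ₑ .reg 2)) ;;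
  .loop (.reg 11 <ₑ .reg 4) (.store (.reg 11) (.const 0) ;; .assign 11 (.reg 11 +ₑ .const 1))

/-- Initialize the records of all chunks. -/
def initChunks : Prog 19 :=
  -- There are 2n + 2 indices: 2i for a left endpoint i and 2j + 1 for a right endpoint j, with i, j
  -- ≤ n.
  (.assign 5 ((.const 2 *ₑ .reg 0 +ₑ .const 2) /ₑ .reg 2 +ₑ .const 1) ;;
  .assign 6 (.reg 4 +ₑ .const 2 *ₑ .reg 5)) ;;
  .loop (.reg 11 <ₑ .reg 6)
    (.store (.reg 11) (.reg 7) ;; .store (.reg 11 +ₑ .const 1) (.const 0) ;;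
      .assign 11 (.reg 11 +ₑ .const 2))

/-- Increment the counter with the index that is the value of `e`. -/
def increment (e : Expr 19) : Prog 19 :=
  .assign 11 e ;; .assign 15 (.reg 4 +ₑ .const 2 *ₑ (.reg 11 /ₑ .reg 2)) ;;
  .load 12 (.reg 15) ;; .load 12 (.reg 12 *ₑ .reg 2 +ₑ .reg 11 %ₑ .reg 2) ;;
  -- A code below 4^h has fewer than h ones and stays in place. Otherwise it becomes a new record at
  -- the head of the list, and the chunk restarts from 2^h, the code of h zero counters.
  .branch (.reg 12 <ₑ .reg 3) (.store (.reg 15) (.reg 12))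
    (.load 14 (.reg 15 +ₑ .const 1) ;; .store (.reg 6) (.reg 12) ;;
      .store (.reg 6 +ₑ .const 1) (.reg 14) ;; .store (.reg 15) (.reg 7) ;;
      .store (.reg 15 +ₑ .const 1) (.reg 6) ;; .assign 6 (.reg 6 +ₑ .const 2))

/-- Count the endpoints of all intervals. -/
def countEndpoints : Prog 19 :=
  .start ;; .next 8 9 10 ;; .loop (.reg 8)
    ((increment (.const 2 *ₑ .reg 9) ;; increment (.const 2 *ₑ .reg 10 +ₑ .const 1)) ;;
      .next 8 9 10)

/-- Add the counters that are packed in register 12 to the cells for the counters of a chunk. -/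
def decode : Prog 19 :=
  .loop (.const 1 <ₑ .reg 12)
    (.branch (.reg 12 %ₑ .const 2)
      (.load 14 (.reg 13) ;; .store (.reg 13) (.reg 14 +ₑ .const 1))
      (.assign 13 (.reg 13 +ₑ .const 1)) ;;
    .assign 12 (.reg 12 /ₑ .const 2))

/-- Add the counters of the linked list that starts at the address in register 15. -/
def gather : Prog 19 :=
  .loop (.reg 15)
    ((.load 12 (.reg 15) ;; .load 15 (.reg 15 +ₑ .const 1) ;; .assign 13 (.reg 17)) ;; decode)

/-- Append the bit in register 18 to the output. -/
def writeBit : Prog 19 :=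
  .load 12 (.reg 6 +ₑ .reg 16 /ₑ .reg 1) ;;
  .store (.reg 6 +ₑ .reg 16 /ₑ .reg 1)
    -- The output cells may hold arbitrary data; the reduction removes all bits from the current
    -- position upwards before the new bit is added.
    (.reg 12 %ₑ (.const 1 ≪ₑ (.reg 16 %ₑ .reg 1)) +ₑ .reg 18 ≪ₑ (.reg 16 %ₑ .reg 1)) ;;
  .assign 16 (.reg 16 +ₑ .const 1)

/-- Append the parentheses of a chunk to the output, and clear its counters. -/
def emit : Prog 19 :=
  .assign 13 (.const 0) ;;
  .loop (.reg 13 <ₑ .reg 2)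
    ((.load 14 (.reg 17 +ₑ .reg 13) ;; .store (.reg 17 +ₑ .reg 13) (.const 0) ;;
      .assign 18 ((.reg 11 *ₑ .reg 2 +ₑ .reg 13 +ₑ .const 1) %ₑ .const 2)) ;;
    .loop (.reg 14) (.assign 14 (.reg 14 -ₑ .const 1) ;; writeBit) ;;
    .assign 13 (.reg 13 +ₑ .const 1))

/-- Append the parentheses of all chunks to the output. -/
def emitAll : Prog 19 :=
  (.assign 16 (.const 0) ;; .assign 11 (.const 0)) ;;
  .loop (.reg 11 <ₑ .reg 5)
    (.assign 15 (.reg 4 +ₑ .const 2 *ₑ .reg 11) ;; gather ;; emit ;;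
      .assign 11 (.reg 11 +ₑ .const 1)) ;;
  (.assign 0 (.reg 6) ;; .assign 1 (.reg 16))

/-- The balanced parentheses of a suffix tree from an enumerator of the suffix-array intervals. -/
def topology : Prog 19 :=
  chooseSize ;; fillTable ;; clearCounters ;; initChunks ;; countEndpoints ;; emitAll

/-! ### Preparation of the memory -/

/-- Parameters of the program: `h` counters are packed in a word, `X = 4 ^ h`, the table has `L`
entries, there are `nc` chunks, and `M` memory cells are in use. -/
structure Params (n w h X L nc M : ℕ) : Prop where
  one_le_n : 1 ≤ n
  one_le_h : 1 ≤ h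
  X_eq : X = 4 ^ h
  L_eq : L = X * h
  n_le : n ≤ X * X
  le_n : X * X ≤ 16 * n
  min : ∀ m, 1 ≤ m → n ≤ 4 ^ m * 4 ^ m → h ≤ m
  nc_eq : nc = (2 * n + 2) / h + 1
  n_lt : 256 * n ≤ 2 ^ w
  M_le : L + h + 2 * nc + 2 * (4 * n / h) + 4 * n / w + 1 ≤ M
  M_lt : M ≤ 2 ^ w

namespace Params
variable {n w h X L nc M : ℕ}

theorem h_lt (P : Params n w h X L nc M) : h < X := P.X_eq ▸ Nat.lt_pow_self (by omega)

theorem L_le (P : Params n w h X L nc M) : L ≤ 16 * n :=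
  P.L_eq ▸ (Nat.mul_le_mul_left X P.h_lt.le).trans P.le_n

theorem X_le (P : Params n w h X L nc M) : X ≤ 16 * n :=
  (Nat.le_mul_self X).trans P.le_n

theorem two_pow_le (P : Params n w h X L nc M) : 2 ^ h ≤ X := P.X_eq ▸ Nat.pow_le_pow_left (by omega) h

/-- If `h > n`, then `h - 1 ≥ n` would already be admissible, against minimality. -/
theorem h_le_n (P : Params n w h X L nc M) : h ≤ n := by
  by_contra hc
  have h1 := P.min (h - 1) (by have := P.one_le_n; omega)
  have h2 : h - 1 < 4 ^ (h - 1) := Nat.lt_pow_self (by omega)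
  have h3 := Nat.le_mul_self (4 ^ (h - 1))
  have := P.one_le_h
  have := h1 (by omega)
  omega

theorem lt_nc_mul (P : Params n w h X L nc M) : 2 * n + 2 < nc * h := by
  rw [P.nc_eq, add_one_mul]
  have := Nat.div_add_mod' (2 * n + 2) h
  have := Nat.mod_lt (2 * n + 2) (show h > 0 from P.one_le_h)
  omega

theorem nc_mul_le (P : Params n w h X L nc M) : nc * h ≤ 2 * n + 2 + h := by
  rw [P.nc_eq, add_one_mul]
  have := Nat.div_mul_le_self (2 * n + 2) h
  omega

theorem nc_le (P : Params n w h X L nc M) : nc ≤ 2 * n + 3 := by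
  rw [P.nc_eq]
  have := Nat.div_le_self (2 * n + 2) h
  omega

theorem base_lt (P : Params n w h X L nc M) : L + h + 2 * nc < M := by
  have := P.M_le
  have := Nat.zero_le (4 * n / h)
  have := Nat.zero_le (4 * n / w)
  omega

theorem w_pos (P : Params n w h X L nc M) : 0 < w := by
  rcases Nat.eq_zero_or_pos w with rfl | h
  · have := P.n_lt; have := P.one_le_n; simp at *; omega
  · exact h

end Params

/-- The registers with a constant value in the main part of the program. -/
structure Regs (n w h X L nc : ℕ) (s : Store 19) : Prop where
  r0 : s.reg 0 = n
  r1 : s.reg 1 = w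
  r2 : s.reg 2 = h
  r3 : s.reg 3 = X
  r4 : s.reg 4 = L + h
  r5 : s.reg 5 = nc
  r7 : s.reg 7 = 2 ^ h
  r17 : s.reg 17 = L

/-! ### Correctness and time of the preparatory phases. -/

section Phases
variable {n w h X L nc M : ℕ} {E : Enumerator}

theorem runs_chooseSize (P : Params n w h X L nc M) {s : Store 19} {e : E.State} (h0 : s.reg 0 = n) (h1 : s.reg 1 = w) :
    Runs E w M chooseSize s e (10 * n) fun s' e' => e' = e ∧ s'.reg 0 = n ∧ s'.reg 1 = w ∧
      s'.reg 2 = h ∧ s'.reg 3 = X := by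
  have hw0 := P.w_pos.ne'
  have hn := P.n_lt
  have hn1 := P.one_le_n
  have := P.h_le_n
  have := P.one_le_h
  refine Runs.mono (T := 1 + (1 + (10 * (h - 1) + 3))) (Runs.seq (R := fun s' e' => e' = e ∧ s'.reg 0 = n ∧ s'.reg 1 = w ∧
    s'.reg 2 = 1) (Runs.of_wp_le P.w_pos (by decide) ?_) fun s₁ e₁ hs₁ =>
      Runs.seq (R := fun s' e' => e' = e ∧ s'.reg 0 = n ∧ s'.reg 1 = w ∧
    s'.reg 2 = 1 ∧ s'.reg 3 = 4) (Runs.of_wp_le P.w_pos (by decide) ?_) fun s₂ e₂ hs₂ =>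
      Runs.loop P.w_pos (fun b s' e' => e' = e ∧ s'.reg 0 = n ∧ s'.reg 1 = w ∧ ∃ m, 1 ≤ m ∧ m ≤ h ∧
        s'.reg 2 = m ∧ s'.reg 3 = 4 ^ m ∧ b = 10 * (h - m) + 3) ?_ ?_ ?_
        ⟨hs₂.1, hs₂.2.1, hs₂.2.2.1, 1, le_rfl, P.one_le_h, hs₂.2.2.2.1, hs₂.2.2.2.2, rfl⟩) (by omega)
      fun _ _ h => h
  · simp [Prog.wp, Expr.nat, Expr.Fits, h0, h1]; omega
  · simp [Prog.wp, Expr.nat, Expr.Fits, hs₁]; omega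
  · rintro b s e ⟨he, h0, h1, m, hm, hmh, h2, h3, hb⟩
    have : 4 ^ m * 4 ^ m ≤ X * X := by
      rw [P.X_eq]; exact Nat.mul_self_le_mul_self (Nat.pow_le_pow_right (by omega) hmh)
    have := P.le_n
    simp [Expr.Fits, Expr.nat, BinOp.Fits, h3]
    omega
  · rintro b s e' ⟨he, h0, h1, m, hm, hmh, h2, h3, hb⟩ hx
    have hlt : 4 ^ m * 4 ^ m < n := by
      by_contra hc
      simp [Expr.nat, BinOp.nat, h3, h0] at hx
      exact hc hx
    have hmh' : m < h := by
      rcases hmh.lt_or_eq with h | rfl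
      · exact h
      · have := P.n_le; rw [P.X_eq] at this; omega
    have := Nat.le_mul_self (4 ^ m)
    refine ⟨4, 10 * (h - (m + 1)) + 3, ?_, Runs.of_wp_le P.w_pos (by decide) ?_⟩
    · simp [Expr.cost]; omega
    · simp [Prog.wp, Expr.nat, Expr.Fits, BinOp.nat, BinOp.Fits, h0, h1, h2, h3, he]
      refine ⟨by omega, by omega, by omega, ?_⟩
      omega
  · rintro b s e' ⟨he, h0, h1, m, hm, hmh, h2, h3, hb⟩ hx
    have hle : n ≤ 4 ^ m * 4 ^ m := by
      by_contra hc
      simp [Expr.nat, BinOp.nat, h3, h0] at hx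
      omega
    obtain rfl : h = m := le_antisymm (P.min m hm hle) hmh
    exact ⟨by simp [Expr.cost]; omega, he, h0, h1, h2, h3.trans P.X_eq.symm⟩

/-- Entry `x * h + k` is to hold `ins x k`. The recursion for `ins` refers to an earlier row or, for
`x = 0`, to the preceding entry of row 0, so filling by increasing address works. -/
theorem runs_fillTable (P : Params n w h X L nc M) {s : Store 19} {e : E.State} (h0 : s.reg 0 = n) (h1 : s.reg 1 = w)
    (h2 : s.reg 2 = h) (h3 : s.reg 3 = X) :
    Runs E w M fillTable s e (7 + 40 * L) fun s' e' => e' = e ∧ s'.reg 0 = n ∧ s'.reg 1 = w ∧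
      s'.reg 2 = h ∧ s'.reg 3 = X ∧ s'.reg 17 = L ∧ s'.reg 7 = 2 ^ h ∧ s'.reg 11 = L ∧
      ∀ i < L, s'.mem i = ins (i / h) (i % h) := by
  have hw0 := P.w_pos.ne'
  have hn := P.n_lt
  have hn1 := P.one_le_n
  have hh := P.h_le_n
  have hh1 := P.one_le_h
  have hL := P.L_le
  have h2h := P.two_pow_le
  have hX := P.X_le
  have hM := P.base_lt
  have hMw := P.M_lt
  refine Runs.mono (T := 5 + (40 * L + 2)) (Runs.seq (R := fun s' e' => e' = e ∧ s'.reg 0 = n ∧ s'.reg 1 = w ∧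
    s'.reg 2 = h ∧ s'.reg 3 = X ∧ s'.reg 17 = L ∧ s'.reg 7 = 2 ^ h ∧ s'.reg 11 = 0)
    (Runs.of_wp_le P.w_pos (by decide) ?_) fun s₁ e₁ hs₁ =>
      Runs.loop P.w_pos (fun b s' e' => e' = e ∧ s'.reg 0 = n ∧ s'.reg 1 = w ∧
    s'.reg 2 = h ∧ s'.reg 3 = X ∧ s'.reg 17 = L ∧ s'.reg 7 = 2 ^ h ∧ ∃ j, s'.reg 11 = j ∧ j ≤ L ∧
      b = 40 * (L - j) + 2 ∧ ∀ i < j, s'.mem i = ins (i / h) (i % h)) ?_ ?_ ?_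
        ⟨hs₁.1, hs₁.2.1, hs₁.2.2.1, hs₁.2.2.2.1, hs₁.2.2.2.2.1, hs₁.2.2.2.2.2.1,
          hs₁.2.2.2.2.2.2.1, 0, hs₁.2.2.2.2.2.2.2, by omega, rfl, by omega⟩) (by omega)
      fun _ _ h => h
  · simp [Prog.wp, Expr.nat, Expr.Fits, BinOp.nat, BinOp.Fits, h0, h1, h2, h3, ← P.L_eq,
      Nat.shiftLeft_eq]
    omega
  · intro b s e _
    simp [Expr.Fits, BinOp.Fits]
  · rintro b s e' ⟨he, h0, h1, h2, h3, h17, h7, j, h11, hj, hb, htab⟩ hx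
    have hlt : j < L := by
      by_contra hc
      simp [Expr.nat, BinOp.nat, h11, h17] at hx
      exact hc hx
    have hx1 : j / h < X := Nat.div_lt_of_lt_mul (by rw [mul_comm, ← P.L_eq]; exact hlt)
    have hk1 : j % h < h := Nat.mod_lt _ hh1
    have hdm := Nat.div_add_mod' j h
    obtain ⟨x, hxd⟩ : ∃ x, x = j / h := ⟨_, rfl⟩
    obtain ⟨k, hkd⟩ : ∃ k, k = j % h := ⟨_, rfl⟩
    rw [← hxd] at hx1
    rw [← hkd] at hk1
    rw [← hxd, ← hkd] at hdm
    -- An entry has at most 2h + k' + 1 ≤ 4h bits, so it is below X² ≤ 16n and fits into a word.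
    have hins : ∀ x' < X, ∀ k' < h, ins x' k' < 2 ^ w := by
      intro x' hx' k' hk'
      have h1 : x' < 2 ^ (2 * h) := by rw [pow_mul]; exact P.X_eq ▸ hx'
      have h2 := ins_lt _ _ k' h1
      have h3 : 2 ^ (2 * h + k' + 1) ≤ 2 ^ (2 * h + 2 * h) :=
        Nat.pow_le_pow_right (by omega) (by omega)
      rw [pow_add _ (2 * h) (2 * h), pow_mul, show (2 ^ 2) ^ h = X from P.X_eq.symm] at h3
      have := P.le_n
      omega
    have hread : ∀ x' < x, ∀ k' < h, s.mem (x' * h + k') = ins x' k' ∧ x' * h + k' < j := by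
      intro x' hx' k' hk'
      have h1 : (x' + 1) * h ≤ x * h := Nat.mul_le_mul_right h hx'
      rw [add_one_mul] at h1
      have h2 : x' * h + k' < j := by omega
      have := htab _ h2
      rw [mul_comm, Nat.mul_add_div hh1, Nat.div_eq_of_lt hk', Nat.mul_add_mod,
        Nat.mod_eq_of_lt hk', add_zero] at this
      rw [mul_comm]
      exact ⟨this, by rwa [mul_comm]⟩
    have hval := hins x hx1 k hk1
    refine ⟨35, 40 * (L - (j + 1)) + 2, ?_, Runs.of_wp_le P.w_pos (by decide) ?_⟩
    · simp [Expr.cost]; omega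
    · have fin : ∀ v, v = ins x k → ∀ i ≤ j, Function.update s.mem j v i = ins (i / h) (i % h) := by
        rintro v rfl i hi
        rcases hi.lt_or_eq with h | rfl
        · rw [Function.update_of_ne (by omega)]; exact htab i h
        · simp [hxd, hkd]
      simp [fillEntry, Prog.wp, Expr.nat, Expr.Fits, BinOp.nat, BinOp.Fits, h0, h1, h2, h3, h11, h17,
        h7, he, ← hxd, ← hkd]
      have hxh : x / 2 * h ≤ x * h := Nat.mul_le_mul_right h (Nat.div_le_self x 2)
      refine ⟨fun hk => ⟨by omega, fun hx2 => ?_, fun hx2 => ?_⟩, fun hk => ?_⟩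
      · have hr := (hread (x / 2) (by omega) k hk1).1
        have hi := ins_odd x k hk (by omega)
        rw [hr]
        and_intros <;> first | omega | exact fin _ hi.symm
      · have hi := ins_even x k hk hx2
        have hr : s.mem (x / 2 * h + (k - 1)) = ins (x / 2) (k - 1) := by
          by_cases hx0 : x = 0
          · have hr := htab (k - 1) (by omega)
            rw [Nat.div_eq_of_lt (show k - 1 < h by omega),
              Nat.mod_eq_of_lt (show k - 1 < h by omega)] at hr
            simpa [hx0] using hr
          · exact (hread (x / 2) (by omega) (k - 1) (by omega)).1
        rw [hr]
        and_intros <;> first | omega | exact fin _ hi.symm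
      · have hi := ins_zero x
        rw [← hk] at hi
        and_intros <;> first | omega | exact fin _ hi.symm
  · rintro b s e' ⟨he, h0, h1, h2, h3, h17, h7, j, h11, hj, hb, htab⟩ hx
    have hle : L ≤ j := by
      by_contra hc
      simp [Expr.nat, BinOp.nat, h11, h17] at hx
      omega
    obtain rfl : j = L := le_antisymm hj hle
    exact ⟨by simp [Expr.cost]; omega, he, h0, h1, h2, h3, h17, h7, h11, htab⟩

theorem runs_clearCounters (P : Params n w h X L nc M) {s : Store 19} {e : E.State} (h0 : s.reg 0 = n) (h1 : s.reg 1 = w)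
    (h2 : s.reg 2 = h) (h3 : s.reg 3 = X) (h17 : s.reg 17 = L) (h7 : s.reg 7 = 2 ^ h)
    (h11 : s.reg 11 = L) (htab : ∀ i < L, s.mem i = ins (i / h) (i % h)) :
    Runs E w M clearCounters s e (10 * h + 4) fun s' e' => e' = e ∧ s'.reg 0 = n ∧ s'.reg 1 = w ∧
      s'.reg 2 = h ∧ s'.reg 3 = X ∧ s'.reg 17 = L ∧ s'.reg 7 = 2 ^ h ∧ s'.reg 4 = L + h ∧
      s'.reg 11 = L + h ∧ (∀ i < L, s'.mem i = ins (i / h) (i % h)) ∧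
      ∀ i < h, s'.mem (L + i) = 0 := by
  have hw0 := P.w_pos.ne'
  have hM := P.base_lt
  have hMw := P.M_lt
  refine Runs.mono (T := 2 + (10 * h + 2)) (Runs.seq (R := fun s' e' => e' = e ∧ s'.reg 0 = n ∧
    s'.reg 1 = w ∧ s'.reg 2 = h ∧ s'.reg 3 = X ∧ s'.reg 17 = L ∧ s'.reg 7 = 2 ^ h ∧
    s'.reg 4 = L + h ∧ s'.reg 11 = L ∧ (∀ i < L, s'.mem i = ins (i / h) (i % h)))
    (Runs.of_wp_le P.w_pos (by decide) ?_) fun s₁ e₁ hs₁ =>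
      Runs.loop P.w_pos (fun b s' e' => e' = e ∧ s'.reg 0 = n ∧ s'.reg 1 = w ∧
      s'.reg 2 = h ∧ s'.reg 3 = X ∧ s'.reg 17 = L ∧ s'.reg 7 = 2 ^ h ∧ s'.reg 4 = L + h ∧
      (∀ i < L, s'.mem i = ins (i / h) (i % h)) ∧ ∃ j, s'.reg 11 = L + j ∧ j ≤ h ∧
      b = 10 * (h - j) + 2 ∧ ∀ i < j, s'.mem (L + i) = 0) ?_ ?_ ?_ ?_) (by omega)
      fun _ _ h => h
  · simp [Prog.wp, Expr.nat, Expr.Fits, BinOp.nat, BinOp.Fits, h0, h1, h2, h3, h17, h7, h11]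
    exact ⟨by omega, htab⟩
  · intro b s e _
    simp [Expr.Fits, BinOp.Fits]
  · rintro b s e' ⟨he, h0, h1, h2, h3, h17, h7, h4, htab, j, h11, hj, hb, hz⟩ hx
    have hlt : j < h := by
      by_contra hc
      simp [Expr.nat, BinOp.nat, h11, h4] at hx
      exact hc hx
    refine ⟨3, 10 * (h - (j + 1)) + 2, ?_, Runs.of_wp_le P.w_pos (by decide) ?_⟩
    · simp [Expr.cost]; omega
    · simp [Prog.wp, Expr.nat, Expr.Fits, BinOp.nat, BinOp.Fits, h0, h1, h2, h3, h11, h17, h7, h4,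
        he]
      refine ⟨by omega, ⟨by omega, by omega⟩, fun i hi => ?_, j + 1, by omega, by omega, rfl,
        fun i hi => ?_⟩
      · rw [Function.update_of_ne (by omega)]; exact htab i hi
      · rcases Nat.lt_succ_iff_lt_or_eq.1 hi with h | rfl
        · rw [Function.update_of_ne (by omega)]; exact hz i h
        · simp
  · rintro b s e' ⟨he, h0, h1, h2, h3, h17, h7, h4, htab, j, h11, hj, hb, hz⟩ hx
    have hle : h ≤ j := by
      by_contra hc
      simp [Expr.nat, BinOp.nat, h11, h4] at hx
      omega
    obtain rfl : j = h := le_antisymm hj hle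
    exact ⟨by simp [Expr.cost]; omega, he, h0, h1, h2, h3, h17, h7, h4, h11, htab, hz⟩
  · obtain ⟨he, h0, h1, h2, h3, h17, h7, h4, h11, htab⟩ := hs₁
    exact ⟨he, h0, h1, h2, h3, h17, h7, h4, htab, 0, h11, by omega, rfl, by omega⟩

theorem runs_initChunks (P : Params n w h X L nc M) {s : Store 19} {e : E.State} (h0 : s.reg 0 = n) (h1 : s.reg 1 = w)
    (h2 : s.reg 2 = h) (h3 : s.reg 3 = X) (h17 : s.reg 17 = L) (h7 : s.reg 7 = 2 ^ h)
    (h4 : s.reg 4 = L + h)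
    (h11 : s.reg 11 = L + h) (htab : ∀ i < L, s.mem i = ins (i / h) (i % h))
    (hcnt : ∀ i < h, s.mem (L + i) = 0) :
    Runs E w M initChunks s e (10 * nc + 10) fun s' e' => e' = e ∧ Regs n w h X L nc s' ∧
      s'.reg 6 = L + h + 2 * nc ∧ (∀ i < L, s'.mem i = ins (i / h) (i % h)) ∧
      (∀ i < h, s'.mem (L + i) = 0) ∧
      ∀ c < nc, s'.mem (L + h + 2 * c) = 2 ^ h ∧ s'.mem (L + h + 2 * c + 1) = 0 := by
  have hw0 := P.w_pos.ne'
  have hM := P.base_lt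
  have hMw := P.M_lt
  have hn := P.n_lt
  have hn1 := P.one_le_n
  have hnc := P.nc_eq
  have hncl := P.nc_le
  refine Runs.mono (T := 8 + (10 * nc + 2)) (Runs.seq (R := fun s' e' => e' = e ∧
      Regs n w h X L nc s' ∧ s'.reg 6 = L + h + 2 * nc ∧ s'.reg 11 = L + h ∧
      (∀ i < L, s'.mem i = ins (i / h) (i % h)) ∧ (∀ i < h, s'.mem (L + i) = 0))
    (Runs.of_wp_le P.w_pos (by decide) ?_) fun s₁ e₁ hs₁ =>
      Runs.loop P.w_pos (fun b s' e' => e' = e ∧ Regs n w h X L nc s' ∧ s'.reg 6 = L + h + 2 * nc ∧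
      (∀ i < L, s'.mem i = ins (i / h) (i % h)) ∧ (∀ i < h, s'.mem (L + i) = 0) ∧
      ∃ j, s'.reg 11 = L + h + 2 * j ∧ j ≤ nc ∧ b = 10 * (nc - j) + 2 ∧
      ∀ c < j, s'.mem (L + h + 2 * c) = 2 ^ h ∧ s'.mem (L + h + 2 * c + 1) = 0) ?_ ?_ ?_ ?_)
      (by omega) fun _ _ h => h
  · simp [Prog.wp, Expr.nat, Expr.Fits, BinOp.nat, BinOp.Fits, h0, h2, h11, h4, ← hnc]
    refine ⟨by omega, by omega, ?_, htab, hcnt⟩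
    constructor <;> simp [*]
  · intro b s e _
    simp [Expr.Fits, BinOp.Fits]
  · rintro b s e' ⟨he, hr, h6, htab, hcnt, j, h11, hj, hb, hz⟩ hx
    have hlt : j < nc := by
      by_contra hc
      simp [Expr.nat, BinOp.nat, h11, h6] at hx
      exact hc hx
    refine ⟨6, 10 * (nc - (j + 1)) + 2, ?_, Runs.of_wp_le P.w_pos (by decide) ?_⟩
    · simp [Expr.cost]; omega
    · simp [Prog.wp, Expr.nat, Expr.Fits, BinOp.nat, BinOp.Fits, h11, hr.r7, h6, he]
      refine ⟨by omega, ⟨by omega, by omega⟩, by omega, ⟨by omega, by omega⟩, ?_, ?_, ?_, j + 1,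
        by omega, by omega, rfl, ?_⟩
      · obtain ⟨a0, a1, a2, a3, a4, a5, a7, a17⟩ := hr
        constructor <;> simp [*]
      · intro i hi
        rw [Function.update_of_ne (by omega), Function.update_of_ne (by omega)]
        exact htab i hi
      · intro i hi
        rw [Function.update_of_ne (by omega), Function.update_of_ne (by omega)]
        exact hcnt i hi
      · intro c hc
        rcases Nat.lt_succ_iff_lt_or_eq.1 hc with h | rfl
        · rw [Function.update_of_ne (by omega), Function.update_of_ne (by omega),
            Function.update_of_ne (by omega), Function.update_of_ne (by omega)]
          exact hz c h
        · simp
  · rintro b s e' ⟨he, hr, h6, htab, hcnt, j, h11, hj, hb, hz⟩ hx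
    have hle : nc ≤ j := by
      by_contra hc
      simp [Expr.nat, BinOp.nat, h11, h6] at hx
      omega
    obtain rfl : j = nc := le_antisymm hj hle
    exact ⟨by simp [Expr.cost]; omega, he, hr, h6, htab, hcnt, hz⟩
  · obtain ⟨he, hr, h6, h11, htab, hcnt⟩ := hs₁
    exact ⟨he, hr, h6, htab, hcnt, 0, h11, by omega, rfl, by omega⟩

end Phases

/-! ### Counting the endpoints -/

theorem sum_range_add_of_eq {N c : ℕ} (hc : c < N) {f g : ℕ → ℕ} {d : ℕ} (h0 : g c = f c + d)
    (h : ∀ i, i ≠ c → g i = f i) :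
    ∑ i ∈ Finset.range N, g i = ∑ i ∈ Finset.range N, f i + d := by
  have hm : c ∈ Finset.range N := Finset.mem_range.2 hc
  rw [← Finset.add_sum_erase _ g hm, ← Finset.add_sum_erase _ f hm, h0,
    Finset.sum_congr rfl fun i hi => h i (Finset.ne_of_mem_erase hi), add_right_comm]

/-- The data structure represents the counters `D`, whose sum is `m`: the record of chunk `c` holds
`cv c`, and its linked list holds `pv c`. -/
structure Counts (n w h X L nc : ℕ) (D : ℕ → ℕ) (m : ℕ) (cv : ℕ → List ℕ) (pv : ℕ → List (List ℕ))
    (s : Store 19) : Prop where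
  regs : Regs n w h X L nc s
  table : ∀ i < L, s.mem i = ins (i / h) (i % h)
  zero : ∀ i < h, s.mem (L + i) = 0
  free : s.reg 6 = L + h + 2 * nc + 2 * ∑ c ∈ Finset.range nc, (pv c).length
  total : ∑ c ∈ Finset.range nc, ((cv c).sum + h * (pv c).length) = m
  length_eq : ∀ c < nc, (cv c).length = h
  sum_lt : ∀ c < nc, (cv c).sum < h
  current : ∀ c < nc, s.mem (L + h + 2 * c) = enc (cv c)
  chain : ∀ c < nc, Chain s.mem (L + h + 2 * nc) (s.reg 6) (s.mem (L + h + 2 * c + 1)) (pv c)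
  pool : ∀ c < nc, ∀ v ∈ pv c, v.length = h ∧ v.sum = h
  count : ∀ c < nc, ∀ k < h,
    D (c * h + k) = (cv c).getD k 0 + ((pv c).map fun v => v.getD k 0).sum

theorem Counts.frame {n w h X L nc m : ℕ} {D : ℕ → ℕ} {cv : ℕ → List ℕ} {pv : ℕ → List (List ℕ)}
    {s : Store 19} (H : Counts n w h X L nc D m cv pv s) {R : Fin 19 → ℕ}
    (hR : ∀ r, r ≠ 8 → r ≠ 9 → r ≠ 10 → R r = s.reg r) :
    Counts n w h X L nc D m cv pv ⟨R, s.mem⟩ := by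
  obtain ⟨⟨a0, a1, a2, a3, a4, a5, a7, a17⟩, h2, h3, h4, h5, h6, h7, h8, h9, h10, h11⟩ := H
  have e6 := hR 6 (by decide) (by decide) (by decide)
  refine ⟨?_, h2, h3, e6.trans h4, h5, h6, h7, h8, ?_, h10, h11⟩
  · constructor <;> (simp only; rw [hR _ (by decide) (by decide) (by decide)]; assumption)
  · simp only [e6]; exact h9

/-- Each full record stands for exactly `h` increments; this bounds the size of the pool. -/
theorem Counts.pool_le {n w h X L nc m : ℕ} {D : ℕ → ℕ} {cv : ℕ → List ℕ} {pv : ℕ → List (List ℕ)}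
    {s : Store 19} (H : Counts n w h X L nc D m cv pv s) :
    h * ∑ c ∈ Finset.range nc, (pv c).length ≤ m := by
  rw [← H.total, Finset.mul_sum]
  exact Finset.sum_le_sum fun _ _ => Nat.le_add_left _ _

theorem Prog.wp_mono {k w M : ℕ} {p : Prog k} {Q Q' : Store k → Prop} {s : Store k}
    (h : p.wp w M Q s) (hQ : ∀ s, Q s → Q' s) : p.wp w M Q' s := by
  induction p generalizing s Q Q' with
  | skip => exact hQ _ h
  | assign r e => exact ⟨h.1, hQ _ h.2⟩
  | load r a => exact ⟨h.1, h.2.1, hQ _ h.2.2⟩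
  | store a v => exact ⟨h.1, h.2.1, h.2.2.1, hQ _ h.2.2.2⟩
  | seq p q ihp ihq => exact ihp h fun s hs => ihq hs hQ
  | branch e p q ihp ihq => exact ⟨h.1, fun he => ihp (h.2.1 he) hQ, fun he => ihq (h.2.2 he) hQ⟩
  | loop | start | next => exact h

/-- The program has no loop: one lookup gives the new code, which either stays in the chunk or moves
as a whole. Register 10 is tracked because it holds the right endpoint while the left one is being
counted. -/
theorem wp_increment {n w h X L nc M : ℕ} (P : Params n w h X L nc M) {m : ℕ} {D : ℕ → ℕ}
    {cv : ℕ → List ℕ} {pv : ℕ → List (List ℕ)} {s : Store 19}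
    (H : Counts n w h X L nc D m cv pv s) {x : Expr 19} (hx : x.Fits w s.reg)
    (hidx : x.nat s.reg < nc * h) (hm : m + 1 ≤ 4 * n) :
    (increment x).wp w M (fun s' => (∃ cv' pv',
      Counts n w h X L nc (fun i => D i + if i = x.nat s.reg then 1 else 0) (m + 1) cv' pv' s') ∧
      s'.reg 10 = s.reg 10) s := by
  have hw0 := P.w_pos.ne'
  have hM := P.base_lt
  have hMw := P.M_lt
  have hPM := P.M_le
  have hh1 := P.one_le_h
  have hn := P.n_lt
  have hL := P.L_le
  have hpool := H.pool_le
  obtain ⟨hregs, htab, hzero, hfree, htot, hlen, hsum, hcur, hchain, hpv, hcount⟩ := H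
  obtain ⟨idx, hie⟩ : ∃ i, i = x.nat s.reg := ⟨_, rfl⟩
  rw [← hie] at hidx ⊢
  obtain ⟨c, hce⟩ : ∃ c, c = idx / h := ⟨_, rfl⟩
  obtain ⟨k, hke⟩ : ∃ k, k = idx % h := ⟨_, rfl⟩
  have hc : c < nc := hce ▸ Nat.div_lt_of_lt_mul (by rwa [mul_comm])
  have hk : k < h := hke ▸ Nat.mod_lt _ hh1
  have hdm : c * h + k = idx := by rw [hce, hke]; exact Nat.div_add_mod' idx h
  obtain ⟨f, hf⟩ : ∃ f, f = s.reg 6 := ⟨_, rfl⟩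
  obtain ⟨r0, r1, r2, r3, r4, r5, r7, r17⟩ := hregs
  have hXh : X = 2 ^ (2 * h) := by rw [pow_mul]; exact P.X_eq
  have hencX : enc (cv c) < X := by
    refine (enc_bounds (cv c)).2.trans_le (hXh ▸ Nat.pow_le_pow_right (by omega) ?_)
    have := hsum c hc
    have := hlen c hc
    omega
  have hadr : enc (cv c) * h + k < L := by
    have h1 : (enc (cv c) + 1) * h ≤ X * h := Nat.mul_le_mul_right h hencX
    rw [← P.L_eq, add_one_mul] at h1
    omega
  have htabv : s.mem (enc (cv c) * h + k) = enc ((cv c).modify k (· + 1)) := by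
    rw [htab _ hadr, mul_comm, Nat.mul_add_div hh1, Nat.div_eq_of_lt hk, Nat.mul_add_mod,
      Nat.mod_eq_of_lt hk, add_zero, ins_enc _ _ (by rw [hlen c hc]; exact hk)]
  have hvb := enc_bounds ((cv c).modify k (· + 1))
  rw [sum_modify _ _ (by rw [hlen c hc]; exact hk), List.length_modify, hlen c hc] at hvb
  obtain ⟨v, hv⟩ : ∃ v, v = (cv c).modify k (· + 1) := ⟨_, rfl⟩
  have hvl : v.length = h := by rw [hv, List.length_modify, hlen c hc]
  have hvs : v.sum = (cv c).sum + 1 := by rw [hv, sum_modify _ _ (by rw [hlen c hc]; exact hk)]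
  have hvg : ∀ i, v.getD i 0 = (cv c).getD i 0 + if i = k then 1 else 0 :=
    fun i => by rw [hv]; exact getD_modify _ _ _ (by rw [hlen c hc]; exact hk)
  rw [← hv] at htabv hvb
  have hidxeq : ∀ c' k', k' < h → (c' * h + k' = idx ↔ c' = c ∧ k' = k) := by
    intro c' k' hk'
    constructor
    · intro he
      have h1 : c' = c := by
        rw [hce, ← he, mul_comm, Nat.mul_add_div hh1, Nat.div_eq_of_lt hk', add_zero]
      subst h1
      exact ⟨rfl, by omega⟩
    · rintro ⟨rfl, rfl⟩; exact hdm
  have hnch := P.nc_mul_le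
  have hle := P.h_le_n
  have hdX : idx / h ≤ idx := Nat.div_le_self _ _
  simp only [increment, Prog.wp]
  refine ⟨hx, ?_⟩
  simp only [← hie]
  simp [Expr.nat, Expr.Fits, BinOp.nat, BinOp.Fits, r2, r3, r4, r7, ← hf, ← hce, ← hke, hcur c hc,
    htabv]
  refine ⟨by omega, by omega, by omega, by omega, fun hlt => ⟨by omega, ?_⟩, fun hge => ?_⟩
  -- The leading bit of the new code is at position h + sum, so a code below 4^h = 2^(2h) has sum
  -- less than h.
  · have hvlt : v.sum < h := by
      by_contra hcon
      have : X ≤ 2 ^ (h + ((cv c).sum + 1)) := hXh ▸ Nat.pow_le_pow_right (by omega) (by omega)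
      omega
    have hne : ∀ i, i ≠ L + h + 2 * c → Function.update s.mem (L + h + 2 * c) (enc v) i = s.mem i :=
      fun i hi => Function.update_of_ne hi _ _
    refine ⟨Function.update cv c v, pv, ⟨?_, ?_, ?_, ?_, ?_, ?_, ?_, ?_, ?_, hpv, ?_⟩⟩
    · constructor <;> simp [*]
    · intro i hi
      simp only
      rw [hne _ (by omega), htab i hi]
    · intro i hi
      simp only
      rw [hne _ (by omega), hzero i hi]
    · simpa using hfree
    · rw [← htot]
      refine sum_range_add_of_eq hc ?_ fun i hi => ?_
      · rw [Function.update_self, hvs]; omega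
      · rw [Function.update_of_ne hi]
    · intro c' hc'
      rcases eq_or_ne c' c with rfl | hcc
      · rw [Function.update_self, hvl]
      · rw [Function.update_of_ne hcc, hlen c' hc']
    · intro c' hc'
      rcases eq_or_ne c' c with rfl | hcc
      · rwa [Function.update_self]
      · rw [Function.update_of_ne hcc]; exact hsum c' hc'
    · intro c' hc'
      simp only
      rcases eq_or_ne c' c with rfl | hcc
      · rw [Function.update_self, Function.update_self]
      · rw [Function.update_of_ne hcc, hne _ (by omega), hcur c' hc']
    · intro c' hc'
      simp only
      rw [hne _ (by omega)]
      refine (hchain c' hc').mono le_rfl (by simp) fun i hi _ => hne i (by omega)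
    · intro c' hc' k' hk'
      simp only [hidxeq c' k' hk']
      rw [hcount c' hc' k' hk']
      rcases eq_or_ne c' c with rfl | hcc
      · rw [Function.update_self, hvg]; simp; omega
      · rw [Function.update_of_ne hcc]; simp [hcc]
  -- The sum was below h and has grown by one; a sum still below h would give a code below 4^h.
  · have hvh : v.sum = h := by
      by_contra hcon
      have := hsum c hc
      have : 2 ^ (h + ((cv c).sum + 1) + 1) ≤ X := hXh ▸ Nat.pow_le_pow_right (by omega) (by omega)
      omega
    -- Room for the new record: this chunk holds h - 1 units, so with the present increment h more
    -- units complete a record, out of at most 4n.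
    have hsp : ∑ c ∈ Finset.range nc, (pv c).length + 1 ≤ 4 * n / h := by
      rw [Nat.le_div_iff_mul_le (by omega), add_one_mul, mul_comm]
      rw [Finset.sum_add_distrib, ← Finset.mul_sum] at htot
      have := Finset.single_le_sum (f := fun c => (cv c).sum) (fun _ _ => Nat.zero_le _)
        (Finset.mem_range.2 hc)
      omega
    have := Nat.zero_le (4 * n / w)
    rw [← hf] at hfree
    obtain ⟨mem', hmem'⟩ : ∃ mem', mem' = Function.update (Function.update (Function.update
      (Function.update s.mem f (enc v)) (f + 1) (s.mem (L + h + 2 * c + 1))) (L + h + 2 * c) (2 ^ h))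
      (L + h + 2 * c + 1) f := ⟨_, rfl⟩
    have hne : ∀ i, i ≠ L + h + 2 * c → i ≠ L + h + 2 * c + 1 → i < f → mem' i = s.mem i := by
      intro i h1 h2 h3
      rw [hmem', Function.update_of_ne h2, Function.update_of_ne h1,
        Function.update_of_ne (by omega), Function.update_of_ne (by omega)]
    have hm1 : mem' (L + h + 2 * c + 1) = f := by rw [hmem', Function.update_self]
    have hm2 : mem' (L + h + 2 * c) = 2 ^ h := by
      rw [hmem', Function.update_of_ne (by omega), Function.update_self]
    have hm3 : mem' f = enc v := by
      rw [hmem', Function.update_of_ne (by omega), Function.update_of_ne (by omega),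
        Function.update_of_ne (by omega), Function.update_self]
    have hm4 : mem' (f + 1) = s.mem (L + h + 2 * c + 1) := by
      rw [hmem', Function.update_of_ne (by omega), Function.update_of_ne (by omega),
        Function.update_self]
    rw [← hmem']
    refine ⟨⟨by omega, by omega⟩, by omega, by omega, ⟨by omega, by omega⟩, by omega, by omega,
      ⟨by omega, by omega⟩, by omega, ⟨by omega, by omega⟩, ?_⟩
    refine ⟨Function.update cv c (List.replicate h 0), Function.update pv c (v :: pv c),
      ⟨?_, ?_, ?_, ?_, ?_, ?_, ?_, ?_, ?_, ?_, ?_⟩⟩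
    · constructor <;> simp [*]
    · intro i hi
      simp only
      rw [hne _ (by omega) (by omega) (by omega), htab i hi]
    · intro i hi
      simp only
      rw [hne _ (by omega) (by omega) (by omega), hzero i hi]
    · rw [sum_range_add_of_eq (f := fun c => (pv c).length) (d := 1) hc]
      · simp; omega
      · rw [Function.update_self]; rfl
      · intro i hi; rw [Function.update_of_ne hi]
    · rw [← htot]
      refine sum_range_add_of_eq hc ?_ fun i hi => ?_
      · rw [Function.update_self, Function.update_self, List.length_cons, mul_add]
        simp; omega
      · rw [Function.update_of_ne hi, Function.update_of_ne hi]
    · intro c' hc'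
      rcases eq_or_ne c' c with rfl | hcc
      · rw [Function.update_self, List.length_replicate]
      · rw [Function.update_of_ne hcc, hlen c' hc']
    · intro c' hc'
      rcases eq_or_ne c' c with rfl | hcc
      · rw [Function.update_self]; simp; omega
      · rw [Function.update_of_ne hcc]; exact hsum c' hc'
    · intro c' hc'
      simp only
      rcases eq_or_ne c' c with rfl | hcc
      · rw [Function.update_self, hm2, enc_replicate]
      · rw [Function.update_of_ne hcc, hne _ (by omega) (by omega) (by omega), hcur c' hc']
    · intro c' hc'
      simp only [Function.update_self]
      have hch := (hchain c' hc').mono (mem' := mem') (f' := f + 2) le_rfl (by omega)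
        fun i hi hi' => hne i (by omega) (by omega) (by omega)
      rcases eq_or_ne c' c with rfl | hcc
      · rw [Function.update_self, hm1]
        exact ⟨by omega, le_rfl, by omega, hm3, hm4 ▸ hch⟩
      · rw [Function.update_of_ne hcc, hne _ (by omega) (by omega) (by omega)]
        exact hch
    · intro c' hc'
      rcases eq_or_ne c' c with rfl | hcc
      · rw [Function.update_self]
        intro u hu
        rcases List.mem_cons.1 hu with rfl | hu
        · exact ⟨hvl, hvh⟩
        · exact hpv c' hc' u hu
      · rw [Function.update_of_ne hcc]; exact hpv c' hc'
    · intro c' hc' k' hk'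
      simp only [hidxeq c' k' hk']
      rw [hcount c' hc' k' hk']
      rcases eq_or_ne c' c with rfl | hcc
      · rw [Function.update_self, Function.update_self, List.map_cons, List.sum_cons, hvg]
        simp; omega
      · rw [Function.update_of_ne hcc, Function.update_of_ne hcc]; simp [hcc]

/-- The number of intervals of `l` whose left endpoint has the index `i`, plus the number of those
whose right endpoint has the index `i`. -/
def endpoints (l : List (ℕ × ℕ)) (i : ℕ) : ℕ :=
  l.countP (fun I => i == 2 * I.1) + l.countP fun I => i == 2 * I.2 + 1

theorem runs_countEndpoints {n w h X L nc M : ℕ} (P : Params n w h X L nc M) {E : Enumerator}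
    {s : Store 19} {e : E.State} (hr : Regs n w h X L nc s) (h6 : s.reg 6 = L + h + 2 * nc)
    (htab : ∀ i < L, s.mem i = ins (i / h) (i % h)) (hcnt : ∀ i < h, s.mem (L + i) = 0)
    (hz : ∀ c < nc, s.mem (L + h + 2 * c) = 2 ^ h ∧ s.mem (L + h + 2 * c + 1) = 0)
    {l : List (ℕ × ℕ)} {t : ℕ} (hy : E.Yields (E.start e) l t) (hl : l.length ≤ 2 * n)
    (hb : ∀ I ∈ l, 1 ≤ I.1 ∧ I.1 ≤ I.2 ∧ I.2 ≤ n) :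
    Runs E w M countEndpoints s e (E.startCost e + t + 101 * l.length + 1)
      fun s' _ => ∃ cv pv, Counts n w h X L nc (endpoints l) (2 * l.length) cv pv s' := by
  have hn := P.n_lt
  have hn1 := P.one_le_n
  have hw0 := P.w_pos.ne'
  have hnc := P.lt_nc_mul
  have h0 : ∃ cv pv, Counts n w h X L nc (endpoints []) (2 * [].length (α := ℕ × ℕ)) cv pv s := by
    refine ⟨fun _ => List.replicate h 0, fun _ => [], hr, htab, hcnt, by simpa using h6, by simp,
      by simp, fun _ _ => ?_, fun c hc => ?_, fun c hc => (hz c hc).2, by simp, ?_⟩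
    · have := P.one_le_h; simp; omega
    · rw [(hz c hc).1, enc_replicate]
    · intro c hc k hk; simp [endpoints]
  refine Runs.mono (T := E.startCost e + (t + (100 + 1) * l.length + 1)) (Runs.seq Runs.start ?_)
    (by omega) fun _ _ h => h
  rintro s₁ e₁ ⟨rfl, rfl⟩
  have key := Runs.enumerate (w := w) (M := M) (f := (8 : Fin 19)) (a := 9) (b := 10)
    (p := increment (.const 2 *ₑ .reg 9) ;; increment (.const 2 *ₑ .reg 10 +ₑ .const 1)) (K := 100)
    P.w_pos (fun l' s => ∃ cv pv, Counts n w h X L nc (endpoints l') (2 * l'.length) cv pv s) hy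
    (fun J hJ => by have := hb J hJ; omega) (by decide) (by decide) (by decide) (L₀ := [])
    (fun l' s R ⟨cv, pv, H⟩ hR => ⟨cv, pv, H.frame hR⟩) ?_ h0
  · simpa using key
  · rintro l₁ J l₂ s e hll ⟨cv, pv, H⟩ h9 h10
    rw [List.nil_append] at hll
    have hJ := hb J (by rw [hll]; simp)
    have hlen : l₁.length + 1 ≤ l.length := by rw [hll]; simp
    refine Runs.of_wp_le P.w_pos (by decide) ?_
    have hp := wp_increment P H (x := .const 2 *ₑ .reg 9)
      (by simp [Expr.Fits, Expr.nat, BinOp.Fits, h9]; omega)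
      (by simp only [Expr.nat, BinOp.nat, h9]; omega) (by omega)
    rw [Prog.wp]
    refine Prog.wp_mono hp ?_
    rintro s₁ ⟨⟨cv₁, pv₁, H₁⟩, h10'⟩
    rw [h10] at h10'
    have hp₁ := wp_increment P H₁ (x := .const 2 *ₑ .reg 10 +ₑ .const 1)
      (by simp [Expr.Fits, Expr.nat, BinOp.nat, BinOp.Fits, h10']; omega)
      (by simp only [Expr.nat, BinOp.nat, h10']; omega) (by omega)
    refine Prog.wp_mono hp₁ ?_
    rintro s₂ ⟨⟨cv₂, pv₂, H₂⟩, -⟩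
    refine ⟨⟨cv₂, pv₂, ?_⟩, rfl⟩
    have he : endpoints (l₁ ++ [J]) = fun i => (endpoints l₁ i +
        if i = (Expr.const 2 *ₑ Expr.reg 9).nat s.reg then 1 else 0) +
        if i = (Expr.const 2 *ₑ Expr.reg 10 +ₑ Expr.const 1).nat s₁.reg then 1 else 0 := by
      funext i
      simp [endpoints, Expr.nat, BinOp.nat, h9, h10', List.countP_append, List.countP_cons]
      omega
    rw [he, List.length_append]
    exact H₂

/-! ### Writing the parentheses -/

/-- From the low end, a one bit increments the current counter and a zero bit advances to the next;
the final one bit ends the loop. In the invariant `u` is the undecoded rest, and stored values plus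
`u` give the target `g`, whose bound excludes overflow. -/
theorem runs_decode {L h w M : ℕ} {E : Enumerator} (hw : 0 < w) (h2w : 2 < 2 ^ w) (hM : L + h < M)
    (hMw : M ≤ 2 ^ w) (g : ℕ → ℕ) (hg : ∀ i < h, g i < 2 ^ w) {s : Store 19} {e : E.State} {v : List ℕ}
    (h12 : s.reg 12 = enc v) (h13 : s.reg 13 = L) (hv : v.length = h)
    (hm : ∀ i < h, s.mem (L + i) + v.getD i 0 = g i) :
    Runs E w M decode s e (10 * (h + v.sum) + 2) fun s' e' => e' = e ∧
      (∀ i < h, s'.mem (L + i) = g i) ∧ (∀ a, a < L ∨ L + h ≤ a → s'.mem a = s.mem a) ∧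
      ∀ r, r ≠ 12 → r ≠ 13 → r ≠ 14 → s'.reg r = s.reg r := by
  have hw0 := hw.ne'
  refine Runs.loop hw (fun b s' e' => e' = e ∧ (∀ a, a < L ∨ L + h ≤ a → s'.mem a = s.mem a) ∧
    (∀ r, r ≠ 12 → r ≠ 13 → r ≠ 14 → s'.reg r = s.reg r) ∧ ∃ j u, s'.reg 12 = enc u ∧
    s'.reg 13 = L + j ∧ j + u.length = h ∧ b = 10 * (u.length + u.sum) + 2 ∧
    ∀ i < h, s'.mem (L + i) + (if j ≤ i then u.getD (i - j) 0 else 0) = g i) ?_ ?_ ?_ ?_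
  · intro b s' e' _
    have := Nat.one_lt_two_pow hw0
    simpa [Expr.Fits, BinOp.Fits] using hw0
  · rintro b s' e' ⟨he, hmem, hreg, j, u, r12, r13, hj, hb, hcnt⟩ hx
    have hu : u ≠ [] := by
      rintro rfl
      simp [Expr.nat, BinOp.nat, r12, enc] at hx
    obtain ⟨c, u, rfl⟩ := List.exists_cons_of_ne_nil hu
    rw [List.length_cons] at hj
    have hgj := hcnt j (by omega)
    have hgw := hg j (by omega)
    rw [if_pos le_rfl, Nat.sub_self, List.getD_cons_zero] at hgj
    cases c with
    | zero =>
      refine ⟨8, 10 * (u.length + u.sum) + 2, ?_, Runs.of_wp_le hw (by decide) ?_⟩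
      · simp [Expr.cost] at hb ⊢; omega
      · simp [Prog.wp, Expr.nat, Expr.Fits, BinOp.nat, BinOp.Fits, r12, r13, enc_zero_cons, he]
        refine ⟨h2w, ⟨hw0, by omega⟩, h2w, hmem, ?_, j + 1, u, rfl, by omega, by omega, rfl, ?_⟩
        · intro r ha hb hc
          rw [Function.update_of_ne ha, Function.update_of_ne hb, hreg r ha hb hc]
        · intro i hi
          rw [← hcnt i hi]
          congr 1
          rcases lt_trichotomy i j with hlt | rfl | hlt
          · rw [if_neg (by omega), if_neg (by omega)]
          · simp
          · rw [if_pos (by omega), if_pos (by omega), show i - j = (i - (j + 1)) + 1 by omega]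
            simp
    | succ c =>
      refine ⟨8, 10 * ((c :: u).length + (c :: u).sum) + 2, ?_, Runs.of_wp_le hw (by decide) ?_⟩
      · simp [Expr.cost] at hb ⊢; omega
      · simp [Prog.wp, Expr.nat, Expr.Fits, BinOp.nat, BinOp.Fits, r12, r13, enc_succ_cons, he]
        rw [show (2 * enc (c :: u) + 1) / 2 = enc (c :: u) by omega]
        refine ⟨h2w, by omega, ⟨hw0, by omega⟩, by omega, h2w, ?_, ?_, c :: u, rfl,
          by simpa using hj, by simp, ?_⟩
        · intro a ha
          rw [Function.update_of_ne (by omega), hmem a ha]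
        · intro r ha hb hc
          rw [Function.update_of_ne ha, Function.update_of_ne hc, hreg r ha hb hc]
        · intro i hi
          rw [← hcnt i hi]
          rcases eq_or_ne i j with rfl | hne
          · simp; omega
          · rw [Function.update_of_ne (by omega)]
            congr 1
            split_ifs with hij
            · rw [show i - j = (i - (j + 1)) + 1 by omega]
              simp
            · rfl
  · rintro b s' e' ⟨he, hmem, hreg, j, u, r12, r13, hj, hb, hcnt⟩ hx
    have hu : u = [] := by
      rw [← enc_eq_one_iff]
      by_contra hc
      simp [Expr.nat, BinOp.nat, r12] at hx
      omega
    subst hu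
    refine ⟨by simp [Expr.cost, hb], he, fun i hi => ?_, hmem, hreg⟩
    simpa using hcnt i hi
  · exact ⟨rfl, fun _ _ => rfl, fun _ _ _ _ => rfl, 0, v, h12, h13, by omega, by rw [hv],
      by simpa using hm⟩

/-- The hypothesis is `v.sum ≤ h`, not equality, because the list will start with the partly filled
record of the chunk itself, which has the same format as a pool record. -/
theorem runs_gather {L h w M f : ℕ} {E : Enumerator} (hw : 0 < w) (h2w : 2 < 2 ^ w)
    (hM : L + h < M) (hMw : M ≤ 2 ^ w) (hf : f ≤ M)
    (g : ℕ → ℕ) (hg : ∀ i < h, g i < 2 ^ w) {s : Store 19} {e : E.State} {vs : List (List ℕ)}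
    (h17 : s.reg 17 = L) (hvs : ∀ v ∈ vs, v.length = h ∧ v.sum ≤ h)
    (hch : Chain s.mem (L + h) f (s.reg 15) vs)
    (hm : ∀ i < h, s.mem (L + i) + (vs.map fun v => v.getD i 0).sum = g i) :
    Runs E w M gather s e (vs.length * (20 * h + 10) + 1) fun s' e' => e' = e ∧
      (∀ i < h, s'.mem (L + i) = g i) ∧ (∀ a, a < L ∨ L + h ≤ a → s'.mem a = s.mem a) ∧
      ∀ r, r ≠ 12 → r ≠ 13 → r ≠ 14 → r ≠ 15 → s'.reg r = s.reg r := by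
  have hw0 := hw.ne'
  refine Runs.loop hw (fun b s' e' => e' = e ∧ (∀ a, a < L ∨ L + h ≤ a → s'.mem a = s.mem a) ∧
    (∀ r, r ≠ 12 → r ≠ 13 → r ≠ 14 → r ≠ 15 → s'.reg r = s.reg r) ∧ ∃ vs,
    (∀ v ∈ vs, v.length = h ∧ v.sum ≤ h) ∧ Chain s'.mem (L + h) f (s'.reg 15) vs ∧
    (∀ i < h, s'.mem (L + i) + (vs.map fun v => v.getD i 0).sum = g i) ∧
    b = vs.length * (20 * h + 10) + 1) ?_ ?_ ?_ ?_
  · intro b s' e' _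
    exact trivial
  · rintro b s' e' ⟨he, hmem, hreg, vs, hvs, hch, hcnt, hb⟩ hx
    cases vs with
    | nil => exact absurd hch hx
    | cons v vs =>
      obtain ⟨h1, h2, h3, h4, h5⟩ := hch
      obtain ⟨hv1, hv2⟩ := hvs v (by simp)
      have hr17 := hreg 17 (by decide) (by decide) (by decide) (by decide)
      rw [h17] at hr17
      refine ⟨4 + (10 * (h + v.sum) + 2), vs.length * (20 * h + 10) + 1, ?_, Runs.seq
        (R := fun s₁ e₁ => e₁ = e ∧ s₁.mem = s'.mem ∧
          (∀ r, r ≠ 12 → r ≠ 13 → r ≠ 14 → r ≠ 15 → s₁.reg r = s'.reg r) ∧ s₁.reg 12 = enc v ∧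
          s₁.reg 13 = L ∧ s₁.reg 15 = s'.mem (s'.reg 15 + 1))
        (Runs.of_wp_le hw (by decide) ?_) ?_⟩
      · rw [hb, List.length_cons, add_one_mul]
        simp only [Expr.cost]
        omega
      · simp [Prog.wp, Expr.nat, Expr.Fits, BinOp.nat, BinOp.Fits, h4, hr17, he]
        refine ⟨by omega, ⟨hw0, by omega⟩, by omega, ?_⟩
        intro r ha hb hc hd
        rw [Function.update_of_ne hb, Function.update_of_ne hd, Function.update_of_ne ha]
      · rintro s₁ e₁ ⟨rfl, hm₁, hr₁, r12, r13, r15⟩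
        refine Runs.mono (runs_decode hw h2w hM hMw (fun i => s'.mem (L + i) + v.getD i 0) ?_ r12 r13 hv1
          (fun i _ => by rw [hm₁])) le_rfl ?_
        · intro i hi
          have h6 := hcnt i hi
          have h7 := hg i hi
          simp only [List.map_cons, List.sum_cons] at h6 ⊢
          omega
        · rintro s₂ e₂ ⟨rfl, hc₂, hm₂, hr₂⟩
          refine ⟨rfl, fun a ha => ?_, fun r ha hb hc hd => ?_, vs,
            fun v hv => hvs v (List.mem_cons_of_mem _ hv), ?_, fun i hi => ?_, rfl⟩
          · rw [hm₂ a ha, hm₁, hmem a ha]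
          · rw [hr₂ r ha hb hc, hr₁ r ha hb hc hd, hreg r ha hb hc hd]
          · rw [hr₂ 15 (by decide) (by decide) (by decide), r15]
            exact h5.mono le_rfl le_rfl fun i hi _ => by rw [hm₂ i (.inr hi), hm₁]
          · have := hcnt i hi
            simp only [List.map_cons, List.sum_cons] at this
            rw [hc₂ i hi]
            omega
  · rintro b s' e' ⟨he, hmem, hreg, vs, hvs, hch, hcnt, hb⟩ hx
    cases vs with
    | nil =>
      refine ⟨by simp [Expr.cost, hb], he, fun i hi => ?_, hmem, hreg⟩
      simpa using hcnt i hi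
    | cons v vs => exact absurd hx hch.2.2.1
  · exact ⟨rfl, fun _ _ => rfl, fun _ _ _ _ _ => rfl, vs, hvs, hch, hm, rfl⟩

/-- The output `out` is stored from the cell `f` on. -/
def Written (w f : ℕ) (out : List Bool) (s : Store 19) : Prop :=
  s.reg 16 = out.length ∧
    ∀ (i : ℕ) (hi : i < out.length), (s.mem (f + i / w)).testBit (i % w) = out[i]

theorem wp_writeBit {w M f N : ℕ} (hw : 0 < w) (hf : f + N / w < M) (hMw : M ≤ 2 ^ w)
    {s : Store 19} {out : List Bool} {b : Bool} (hN : out.length < N) (hNw : N < 2 ^ w)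
    (h1 : s.reg 1 = w) (h6 : s.reg 6 = f)
    (h18 : s.reg 18 = b.toNat) (hs : Written w f out s) :
    writeBit.wp w M (fun s' => Written w f (out ++ [b]) s' ∧ (∀ a < f, s'.mem a = s.mem a) ∧
      ∀ r, r ≠ 12 → r ≠ 16 → s'.reg r = s.reg r) s := by
  obtain ⟨h16, hout⟩ := hs
  have hw0 := hw.ne'
  obtain ⟨o, ho⟩ : ∃ o, o = out.length := ⟨_, rfl⟩
  rw [← ho] at h16 hN
  have h2 : o / w ≤ N / w := Nat.div_le_div_right hN.le
  have h3 : 2 ^ (o % w) * 2 ≤ 2 ^ w := by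
    rw [← pow_succ]; exact Nat.pow_le_pow_right (by omega) (Nat.mod_lt _ hw)
  have h4 : s.mem (f + o / w) % 2 ^ (o % w) < 2 ^ (o % w) := Nat.mod_lt _ (Nat.two_pow_pos _)
  have h5 : b.toNat * 2 ^ (o % w) ≤ 1 * 2 ^ (o % w) := Nat.mul_le_mul_right _ (Bool.toNat_le b)
  rw [one_mul] at h5
  simp [writeBit, Prog.wp, Expr.nat, Expr.Fits, BinOp.nat, BinOp.Fits, h1, h6, h16, h18,
    Nat.shiftLeft_eq]
  refine ⟨by omega, by omega, by omega, ⟨⟨hw0, by omega⟩, by omega, by omega⟩, by omega,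
    ⟨hw0, by omega⟩, ⟨?_, ?_⟩, ?_, ?_⟩
  · simp [ho]
  · intro i hi
    simp only [List.length_append, List.length_singleton] at hi
    -- The new word keeps the bits below the current position, has `b` there, and zeros above.
    have key : ∀ j, (s.mem (f + o / w) % 2 ^ (o % w) + b.toNat * 2 ^ (o % w)).testBit j =
        if j < o % w then (s.mem (f + o / w)).testBit j else b.toNat.testBit (j - o % w) := by
      intro j
      rw [add_comm, mul_comm, Nat.testBit_two_pow_mul_add _ h4, Nat.testBit_mod_two_pow]
      split_ifs with hj <;> simp [hj]
    rcases Nat.lt_succ_iff_lt_or_eq.1 hi with hi' | rfl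
    · rw [List.getElem_append_left hi', ← hout i hi']
      simp only
      by_cases hd : i / w = o / w
      · have hlt : i % w < o % w := by
          have h6 := Nat.div_add_mod i w
          have h7 := Nat.div_add_mod o w
          rw [hd] at h6
          omega
        rw [hd, Function.update_self, key, if_pos hlt]
      · rw [Function.update_of_ne (by omega)]
    · have hb : (out ++ [b])[out.length] = b := by simp
      rw [hb]
      simp only
      rw [← ho, Function.update_self, key, if_neg (lt_irrefl _)]
      cases b <;> simp
  · intro a ha
    have := Nat.zero_le (o / w)
    rw [Function.update_of_ne (by omega)]
  · intro r ha hb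
    rw [Function.update_of_ne hb, Function.update_of_ne ha]

/-- The parentheses for the counters `g k, …, g (h - 1)` of chunk `c`. -/
def chunkOutput (g : ℕ → ℕ) (c h k : ℕ) : List Bool :=
  (List.range' k (h - k)).flatMap fun i => List.replicate (g i) (decide ((c * h + i) % 2 = 0))

theorem chunkOutput_eq_append (g : ℕ → ℕ) (c : ℕ) {h k : ℕ} (hk : k < h) :
    chunkOutput g c h k =
      List.replicate (g k) (decide ((c * h + k) % 2 = 0)) ++ chunkOutput g c h (k + 1) := by
  rw [chunkOutput, chunkOutput, show h - k = (h - (k + 1)) + 1 by omega, List.range'_succ,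
    List.flatMap_cons]

theorem runs_writeBits {w M f N : ℕ} {E : Enumerator} (hw : 0 < w) (hf : f + N / w < M)
    (hMw : M ≤ 2 ^ w) {s : Store 19} {e : E.State} {out : List Bool} {b : Bool} {y : ℕ}
    (hN : out.length + y ≤ N) (hNw : N < 2 ^ w) (h1 : s.reg 1 = w) (h6 : s.reg 6 = f)
    (h14 : s.reg 14 = y) (h18 : s.reg 18 = b.toNat) (hs : Written w f out s) :
    Runs E w M (.loop (.reg 14) (.assign 14 (.reg 14 -ₑ .const 1) ;; writeBit)) s e (20 * y + 1)
      fun s' e' => e' = e ∧ Written w f (out ++ List.replicate y b) s' ∧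
      (∀ a < f, s'.mem a = s.mem a) ∧ ∀ r, r ≠ 12 → r ≠ 14 → r ≠ 16 → s'.reg r = s.reg r := by
  have hw0 := hw.ne'
  refine Runs.loop hw (fun t s' e' => e' = e ∧ (∀ a < f, s'.mem a = s.mem a) ∧
    (∀ r, r ≠ 12 → r ≠ 14 → r ≠ 16 → s'.reg r = s.reg r) ∧ ∃ z out',
    s'.reg 14 = z ∧ t = 20 * z + 1 ∧ out' ++ List.replicate z b = out ++ List.replicate y b ∧
    Written w f out' s') ?_ ?_ ?_ ?_
  · intro _ _ _ _; exact trivial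
  · rintro t s' e' ⟨he, hmem, hreg, z, out', r14, ht, ho, hW⟩ hx
    have hz : z ≠ 0 := by rintro rfl; exact hx r14
    obtain ⟨z, rfl⟩ := Nat.exists_eq_succ_of_ne_zero hz
    have hlen := congrArg List.length ho
    simp only [List.length_append, List.length_replicate] at hlen
    refine ⟨19, 20 * z + 1, by simp [Expr.cost]; omega, Runs.of_wp_le hw (by decide) ?_⟩
    rw [Prog.wp, Prog.wp]
    refine ⟨by simp [Expr.Fits, Expr.nat, BinOp.Fits, r14, hw0], ?_⟩
    refine Prog.wp_mono (wp_writeBit (b := b) hw hf hMw (out := out') (by omega) hNw ?_ ?_ ?_ ?_) ?_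
    · simp [hreg, h1]
    · simp [hreg, h6]
    · simp [hreg, h18]
    · exact ⟨by simpa using hW.1, hW.2⟩
    · rintro s₁ ⟨hW₁, hm₁, hr₁⟩
      refine ⟨he, fun a ha => (hm₁ a ha).trans (hmem a ha), fun r ha hb hc => ?_, z, out' ++ [b], ?_,
        rfl, ?_, hW₁⟩
      · rw [hr₁ r ha hc]
        simp only
        rw [Function.update_of_ne hb, hreg r ha hb hc]
      · rw [hr₁ 14 (by decide) (by decide)]
        simp [Expr.nat, BinOp.nat, r14]
      · rw [← ho, List.replicate_succ]; simp
  · rintro t s' e' ⟨he, hmem, hreg, z, out', r14, ht, ho, hW⟩ hx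
    have hz : z = 0 := r14.symm.trans hx
    subst hz
    rw [List.replicate_zero, List.append_nil] at ho
    exact ⟨by simp [Expr.cost, ht], he, ho ▸ hW, hmem, hreg⟩
  · exact ⟨rfl, fun _ _ => rfl, fun _ _ _ _ => rfl, y, out, h14, rfl, rfl, hs⟩

theorem runs_emit {n w h X L nc M f N c : ℕ} (P : Params n w h X L nc M) {E : Enumerator}
    (hf : f + N / w < M) (hLf : L + h ≤ f) (hNw : N < 2 ^ w) (hc : c < nc)
    {s : Store 19} {e : E.State} {out : List Bool} {g : ℕ → ℕ}
    (hN : (out ++ chunkOutput g c h 0).length ≤ N) (hr : Regs n w h X L nc s) (h6 : s.reg 6 = f)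
    (h11 : s.reg 11 = c) (hm : ∀ i < h, s.mem (L + i) = g i) (hs : Written w f out s) :
    Runs E w M emit s e (20 * (chunkOutput g c h 0).length + 20 * h + 5) fun s' e' => e' = e ∧
      Written w f (out ++ chunkOutput g c h 0) s' ∧ (∀ i < h, s'.mem (L + i) = 0) ∧
      (∀ a, L + h ≤ a → a < f → s'.mem a = s.mem a) ∧
      ∀ r, r ≠ 12 → r ≠ 13 → r ≠ 14 → r ≠ 16 → r ≠ 18 → s'.reg r = s.reg r := by
  have hw := P.w_pos
  have hw0 := hw.ne'
  have hMw := P.M_lt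
  have hM := P.base_lt
  have hn := P.n_lt
  have hn1 := P.one_le_n
  have hh := P.h_le_n
  have hch : c * h + h ≤ nc * h := by rw [← add_one_mul]; exact Nat.mul_le_mul_right h hc
  have hnch := P.nc_mul_le
  have hNf := Nat.zero_le (N / w)
  refine Runs.mono (T := 1 + (20 * (chunkOutput g c h 0).length + 20 * h + 2)) (Runs.seq
    (R := fun s' e' => e' = e ∧ s'.reg 13 = 0 ∧ s'.mem = s.mem ∧ ∀ r, r ≠ 13 → s'.reg r = s.reg r)
    (Runs.of_wp_le hw (by decide) ?_) fun s₁ e₁ hs₁ =>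
    Runs.loop hw (fun t s' e' => e' = e ∧ (∀ a, L + h ≤ a → a < f → s'.mem a = s.mem a) ∧
      (∀ r : Fin 19, r ≠ 12 → r ≠ 13 → r ≠ 14 → r ≠ 16 → r ≠ 18 → s'.reg r = s.reg r) ∧ ∃ k out',
      s'.reg 13 = k ∧ k ≤ h ∧ out' ++ chunkOutput g c h k = out ++ chunkOutput g c h 0 ∧
      t = 20 * (chunkOutput g c h k).length + 20 * (h - k) + 2 ∧ Written w f out' s' ∧
      (∀ i < k, s'.mem (L + i) = 0) ∧ ∀ i < h, k ≤ i → s'.mem (L + i) = g i) ?_ ?_ ?_ ?_)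
      (by omega) fun _ _ h => h
  · simp [Prog.wp, Expr.nat, Expr.Fits]
    intro r hr
    rw [Function.update_of_ne hr]
  · intro _ _ _ _; simp [Expr.Fits, BinOp.Fits]
  · rintro t s' e' ⟨he, hmem, hreg, k, out', r13, hk, ho, ht, hW, hz, hg⟩ hx
    obtain ⟨r0, r1, r2, r3, r4, r5, r7, r17⟩ := hr
    have e1 := hreg 1 (by decide) (by decide) (by decide) (by decide) (by decide)
    have e2 := hreg 2 (by decide) (by decide) (by decide) (by decide) (by decide)
    have e6 := hreg 6 (by decide) (by decide) (by decide) (by decide) (by decide)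
    have e11 := hreg 11 (by decide) (by decide) (by decide) (by decide) (by decide)
    have e17 := hreg 17 (by decide) (by decide) (by decide) (by decide) (by decide)
    have hkh : k < h := by
      by_contra hcon
      simp [Expr.nat, BinOp.nat, r13, e2, r2] at hx
      exact hcon hx
    have hlen := congrArg List.length ho
    rw [chunkOutput_eq_append g c hkh] at ho ht hlen
    rw [← List.append_assoc] at ho
    simp only [List.length_append, List.length_replicate] at ht hlen hN
    refine ⟨9 + ((20 * g k + 1) + 2), 20 * (chunkOutput g c h (k + 1)).length + 20 * (h - (k + 1)) + 2,
      by simp [Expr.cost]; omega, Runs.seq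
      (R := fun s₁ e₁ => e₁ = e' ∧ s₁.reg 14 = g k ∧
        s₁.reg 18 = (decide ((c * h + k) % 2 = 0)).toNat ∧
        s₁.mem = Function.update s'.mem (L + k) 0 ∧
        ∀ r, r ≠ 14 → r ≠ 18 → s₁.reg r = s'.reg r)
      (Runs.of_wp_le hw (by decide) ?_) ?_⟩
    · simp [Prog.wp, Expr.nat, Expr.Fits, BinOp.nat, BinOp.Fits, r13, e2, r2, e17, r17, e11, h11]
      refine ⟨by omega, by omega, by omega, by omega, ⟨⟨by omega, by omega⟩, by omega⟩,
        hg k hkh le_rfl, ?_, ?_⟩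
      · rcases Nat.mod_two_eq_zero_or_one (c * h + k) with h0 | h0
        · simp [h0]; omega
        · simp [h0]; omega
      · intro r ha hb
        rw [Function.update_of_ne hb, Function.update_of_ne ha]
    · rintro s₁ e₁ ⟨rfl, r14, r18, hm₁, hr₁⟩
      refine Runs.seq (runs_writeBits hw hf hMw (N := N) (b := decide ((c * h + k) % 2 = 0))
        (out := out') (f := f) (y := g k) (by omega) hNw ?_ ?_ r14 r18 ⟨?_, ?_⟩) ?_
      · rw [hr₁ 1 (by decide) (by decide), e1, r1]
      · rw [hr₁ 6 (by decide) (by decide), e6, h6]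
      · rw [hr₁ 16 (by decide) (by decide), hW.1]
      · intro i hi
        have := Nat.zero_le (i / w)
        rw [hm₁, Function.update_of_ne (by omega)]
        exact hW.2 i hi
      · rintro s₂ e₂ ⟨rfl, hW₂, hm₂, hr₂⟩
        refine Runs.of_wp_le hw (by decide) ?_
        have e13 : s₂.reg 13 = k := by
          rw [hr₂ 13 (by decide) (by decide) (by decide), hr₁ 13 (by decide) (by decide), r13]
        have hmm : ∀ a < f, a ≠ L + k → s₂.mem a = s'.mem a := by
          intro a ha hak
          rw [hm₂ a ha, hm₁, Function.update_of_ne hak]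
        have hmk : s₂.mem (L + k) = 0 := by
          rw [hm₂ _ (by omega), hm₁, Function.update_self]
        rw [Prog.wp]
        refine ⟨?_, he, fun a ha hb => ?_, fun r ha hb hc hd he => ?_, k + 1, _, ?_, hkh, ho, rfl, ?_,
          fun i hi => ?_, fun i hi hki => ?_⟩
        · simp [Expr.Fits, Expr.nat, BinOp.Fits, e13]; omega
        · simp only; rw [hmm a hb (by omega), hmem a ha hb]
        · simp only
          rw [Function.update_of_ne hb, hr₂ r ha hc hd, hr₁ r hc he, hreg r ha hb hc hd he]
        · simp [Expr.nat, BinOp.nat, e13]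
        · exact ⟨by simpa using hW₂.1, hW₂.2⟩
        · simp only
          rcases Nat.lt_succ_iff_lt_or_eq.1 hi with hi | rfl
          · rw [hmm _ (by omega) (by omega), hz i hi]
          · exact hmk
        · simp only
          rw [hmm _ (by omega) (by omega), hg i hi (by omega)]
  · rintro t s' e' ⟨he, hmem, hreg, k, out', r13, hk, ho, ht, hW, hz, hg⟩ hx
    have e2 := hreg 2 (by decide) (by decide) (by decide) (by decide) (by decide)
    have hkh : h ≤ k := by
      by_contra hcon
      simp [Expr.nat, BinOp.nat, r13, e2, hr.r2] at hx
      omega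
    obtain rfl : k = h := le_antisymm hk hkh
    have h0 : chunkOutput g c k k = [] := by simp [chunkOutput]
    rw [h0, List.append_nil] at ho
    exact ⟨by simp [Expr.cost]; omega, he, ho ▸ hW, hz, hmem, hreg⟩
  · obtain ⟨he, r13, hm₁, hr₁⟩ := hs₁
    refine ⟨he, fun a _ _ => by rw [hm₁], fun r _ hb _ _ _ => hr₁ r hb, 0, out, r13, by omega, rfl,
      rfl, ⟨?_, ?_⟩, by simp, fun i hi _ => by rw [hm₁]; exact hm i hi⟩
    · rw [hr₁ 16 (by decide)]; exact hs.1
    · rw [hm₁]; exact hs.2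

/-- The parentheses for the counters with the indices `a, …, a + m - 1`. -/
def output (D : ℕ → ℕ) (a m : ℕ) : List Bool :=
  (List.range' a m).flatMap fun i => List.replicate (D i) (decide (i % 2 = 0))

theorem output_add (D : ℕ → ℕ) (a m m' : ℕ) :
    output D a (m + m') = output D a m ++ output D (a + m) m' := by
  rw [output, ← List.range'_append_1, List.flatMap_append]; rfl

theorem chunkOutput_eq_output (D : ℕ → ℕ) (c h : ℕ) :
    chunkOutput (fun i => D (c * h + i)) c h 0 = output D (c * h) h := by
  have : List.range' (c * h) h = (List.range' 0 h).map (c * h + ·) := by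
    rw [List.map_add_range']; simp
  rw [output, this, List.flatMap_map]
  rfl

/-- The remaining time is charged to three resources: the parentheses still to be written, the
chunks still to be treated, and their pool records at `K` units each. Decoding a record takes O(h)
time, but there are only O(n/h) chunks and records, so the total is O(n). -/
theorem runs_emitAll {n w h X L nc M m f : ℕ} (P : Params n w h X L nc M) {E : Enumerator}
    {s : Store 19} {e : E.State} {D : ℕ → ℕ} {cv : ℕ → List ℕ} {pv : ℕ → List (List ℕ)}
    (H : Counts n w h X L nc D m cv pv s) (hm : m ≤ 4 * n) (h6 : s.reg 6 = f)
    (hD : (output D 0 (nc * h)).length ≤ 4 * n) :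
    Runs E w M emitAll s e (1000 * n) fun s' _ =>
      (s'.reg 1 = (output D 0 (nc * h)).length) ∧ s'.reg 0 = f ∧ f + 4 * n / w < M ∧
      ∀ (i : ℕ) (hi : i < (output D 0 (nc * h)).length),
        (s'.mem (f + i / w)).testBit (i % w) = (output D 0 (nc * h))[i] := by
  have hw := P.w_pos
  have hw0 := hw.ne'
  have hMw := P.M_lt
  have hM := P.base_lt
  have hPM := P.M_le
  have hn := P.n_lt
  have hn1 := P.one_le_n
  have hh := P.h_le_n
  have hh1 := P.one_le_h
  have hnch := P.nc_mul_le
  have hncl := P.nc_le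
  have hpool := H.pool_le
  obtain ⟨S, hS⟩ : ∃ S, S = ∑ c ∈ Finset.range nc, (pv c).length := ⟨_, rfl⟩
  rw [← hS] at hpool
  have hfe := H.free
  rw [h6, ← hS] at hfe
  have hSle : S ≤ 4 * n / h := by
    rw [Nat.le_div_iff_mul_le (by omega), mul_comm]; omega
  have hNf := Nat.zero_le (4 * n / w)
  have hfM : f + 4 * n / w < M := by omega
  obtain ⟨full, hfull⟩ : ∃ l, l = output D 0 (nc * h) := ⟨_, rfl⟩
  rw [← hfull] at hD ⊢
  obtain ⟨K, hK⟩ : ∃ K, K = 20 * h + 10 := ⟨_, rfl⟩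
  have hKS : S * K ≤ 120 * n := by
    rw [hK, mul_add, show S * (20 * h) = 20 * (h * S) by ring]
    have : 1 * S ≤ h * S := Nat.mul_le_mul_right _ hh1
    omega
  have hKn : nc * (2 * K + 40) ≤ 600 * n := by
    rw [hK, show nc * (2 * (20 * h + 10) + 40) = 40 * (nc * h) + 60 * nc by ring]
    omega
  refine Runs.mono (T := 10 + ((20 * full.length + nc * (2 * K + 40) + S * K + 2) + 10)) (Runs.seq
    (R := fun s' e' => s'.mem = s.mem ∧ s'.reg 16 = 0 ∧ s'.reg 11 = 0 ∧
      ∀ r, r ≠ 11 → r ≠ 16 → s'.reg r = s.reg r)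
    (Runs.of_wp_le hw (by decide) ?_) fun s₁ e₁ hs₁ => Runs.seq
    (R := fun s' _ => Written w f full s' ∧ s'.reg 6 = f)
    (Runs.loop hw (fun t s' _ => (∀ a, L + h ≤ a → a < f → s'.mem a = s.mem a) ∧
      Regs n w h X L nc s' ∧ s'.reg 6 = f ∧ (∀ i < h, s'.mem (L + i) = 0) ∧ ∃ c out,
      s'.reg 11 = c ∧ c ≤ nc ∧ out ++ output D (c * h) ((nc - c) * h) = full ∧
      t = 20 * (output D (c * h) ((nc - c) * h)).length + (nc - c) * (2 * K + 40) +
        (∑ i ∈ Finset.Ico c nc, (pv i).length) * K + 2 ∧ Written w f out s') ?_ ?_ ?_ ?_)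
      fun s₂ e₂ hs₂ => Runs.of_wp_le hw (by decide) ?_) (by omega) fun _ _ h => h
  · simp [Prog.wp, Expr.nat, Expr.Fits]
    intro r ha hb
    rw [Function.update_of_ne ha, Function.update_of_ne hb]
  · intro _ _ _ _; simp [Expr.Fits, BinOp.Fits]
  · rintro t s' e' ⟨hmem, hr, r6, hz, c, out, r11, hc, ho, ht, hW⟩ hx
    obtain ⟨r0, r1, r2, r3, r4, r5, r7, r17⟩ := id hr
    have hcn : c < nc := by
      by_contra hcon
      simp [Expr.nat, BinOp.nat, r11, r5] at hx
      exact hcon hx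
    obtain ⟨d, hd⟩ : ∃ d, d = nc - (c + 1) := ⟨_, rfl⟩
    have hd' : nc - c = d + 1 := by omega
    rw [hd', add_one_mul, add_comm (d * h) h, output_add, ← add_one_mul c h,
      ← chunkOutput_eq_output] at ho ht
    rw [add_one_mul d (2 * K + 40), Finset.sum_eq_sum_Ico_succ_bot hcn, add_mul _ _ K, List.length_append] at ht
    have hlen := congrArg List.length ho
    simp only [List.length_append] at hlen
    refine ⟨8 + (((1 + (pv c).length) * K + 1) +
        ((20 * (chunkOutput (fun i => D (c * h + i)) c h 0).length + 20 * h + 5) + 2)),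
      20 * (output D ((c + 1) * h) (d * h)).length + d * (2 * K + 40) +
        (∑ i ∈ Finset.Ico (c + 1) nc, (pv i).length) * K + 2, ?_, ?_⟩
    · rw [add_mul, one_mul]
      simp only [Expr.cost]
      omega
    refine Runs.seq (R := fun s₂ e₂ => e₂ = e' ∧ s₂.mem = s'.mem ∧ s₂.reg 15 = L + h + 2 * c ∧
      ∀ r, r ≠ 15 → s₂.reg r = s'.reg r) (Runs.of_wp_le hw (by decide) ?_) ?_
    · simp [Prog.wp, Expr.nat, Expr.Fits, BinOp.nat, BinOp.Fits, r4, r11]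
      refine ⟨by omega, ?_⟩
      intro r ha
      rw [Function.update_of_ne ha]
    rintro s₂ e₂ ⟨rfl, hm₂, r15, hr₂⟩
    -- The record of the chunk is traversed as the head of its own linked list.
    refine Runs.seq (runs_gather (L := L) (h := h) (f := f) (vs := cv c :: pv c) hw (by omega) (by omega) hMw
      (by omega) (fun i => D (c * h + i)) ?_ ?_ ?_ ?_ ?_ |>.mono (T' := (1 + (pv c).length) * K + 1)
      (by rw [List.length_cons, ← hK, add_comm 1]) fun _ _ h => h) ?_
    · intro i hi
      -- A counter is at most the number of parentheses it produces, hence at most 4n, and fits into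
      -- a word.
      have hle : D (c * h + i) ≤ (chunkOutput (fun i => D (c * h + i)) c h 0).length := by
        rw [chunkOutput, List.length_flatMap]
        refine le_trans (le_of_eq ?_) (List.single_le_sum (fun _ _ => Nat.zero_le _) _
          (List.mem_map.2 ⟨i, List.mem_range'_1.2 ⟨by omega, by omega⟩, rfl⟩))
        simp
      omega
    · rw [hr₂ 17 (by decide), r17]
    · intro v hv
      rcases List.mem_cons.1 hv with rfl | hv
      · exact ⟨H.length_eq c hcn, (H.sum_lt c hcn).le⟩
      · obtain ⟨h1, h2⟩ := H.pool c hcn v hv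
        exact ⟨h1, h2.le⟩
    · rw [r15]
      have hch := (H.chain c hcn).mono (mem' := s₂.mem) (p' := L + h) (f' := f) (by omega)
        (by omega) fun i hi hi' => by rw [hm₂, hmem i (by omega) (by omega)]
      refine ⟨by omega, by omega, by omega, ?_, ?_⟩
      · rw [hm₂, hmem _ (by omega) (by omega), H.current c hcn]
      · rw [hm₂, hmem _ (by omega) (by omega), ← hm₂]; exact hch
    · intro i hi
      rw [hm₂, hz i hi, List.map_cons, List.sum_cons, H.count c hcn i hi, zero_add]
    · rintro s₃ e₃ ⟨rfl, hc₃, hm₃, hr₃⟩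
      have hR : ∀ {s₀ : Store 19}, (∀ r, r ≠ 11 → r ≠ 12 → r ≠ 13 → r ≠ 14 → r ≠ 15 → r ≠ 16 →
          r ≠ 18 → s₀.reg r = s'.reg r) → Regs n w h X L nc s₀ := by
        intro s₀ hs₀
        constructor <;>
        · rw [hs₀ _ (by decide) (by decide) (by decide) (by decide) (by decide) (by decide)
            (by decide)]
          assumption
      have hr₃' : ∀ r, r ≠ 12 → r ≠ 13 → r ≠ 14 → r ≠ 15 → s₃.reg r = s'.reg r :=
        fun r ha hb hc hd => (hr₃ r ha hb hc hd).trans (hr₂ r hd)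
      refine Runs.seq (runs_emit (N := 4 * n) (f := f) (c := c) (out := out)
        (g := fun i => D (c * h + i)) P hfM (by omega) (by omega) hcn
        (by rw [List.length_append]; omega) (hR fun r _ ha hb hc hd _ _ => hr₃' r ha hb hc hd)
        ?_ ?_ hc₃ ⟨?_, ?_⟩) ?_
      · rw [hr₃' 6 (by decide) (by decide) (by decide) (by decide), r6]
      · rw [hr₃' 11 (by decide) (by decide) (by decide) (by decide), r11]
      · rw [hr₃' 16 (by decide) (by decide) (by decide) (by decide), hW.1]
      · intro i hi
        have := Nat.zero_le (i / w)
        rw [hm₃ _ (by omega), hm₂]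
        exact hW.2 i hi
      · rintro s₄ e₄ ⟨rfl, hW₄, hz₄, hm₄, hr₄⟩
        have hr₄' : ∀ r, r ≠ 12 → r ≠ 13 → r ≠ 14 → r ≠ 15 → r ≠ 16 → r ≠ 18 →
            s₄.reg r = s'.reg r :=
          fun r ha hb hc hd he hf => (hr₄ r ha hb hc he hf).trans (hr₃' r ha hb hc hd)
        have e11 : s₄.reg 11 = c := by
          rw [hr₄' 11 (by decide) (by decide) (by decide) (by decide) (by decide) (by decide), r11]
        refine Runs.of_wp_le hw (by decide) ⟨?_, fun a ha hb => ?_, hR fun r h11 ha hb hc hd he hf => ?_,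
          ?_, hz₄, c + 1, out ++ chunkOutput (fun i => D (c * h + i)) c h 0, ?_, hcn, ?_, ?_, ?_, ?_⟩
        · simp [Expr.Fits, Expr.nat, BinOp.Fits, e11, hw0]; omega
        · simp only
          rw [hm₄ a ha hb, hm₃ a (.inr ha), hm₂, hmem a ha hb]
        · simp only
          rw [Function.update_of_ne h11, hr₄' r ha hb hc hd he hf]
        · simp only
          rw [Function.update_of_ne (by decide), hr₄' 6 (by decide) (by decide) (by decide)
            (by decide) (by decide) (by decide), r6]
        · simp [Expr.nat, BinOp.nat, e11]
        · rw [← hd, List.append_assoc]; exact ho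
        · rw [← hd]
        · simpa using hW₄.1
        · exact hW₄.2
  · rintro t s' e' ⟨hmem, hr, r6, hz, c, out, r11, hc, ho, ht, hW⟩ hx
    have hcn : nc ≤ c := by
      by_contra hcon
      simp [Expr.nat, BinOp.nat, r11, hr.r5] at hx
      omega
    obtain rfl : c = nc := le_antisymm hc hcn
    rw [Nat.sub_self, zero_mul, output, List.range'_zero, List.flatMap_nil, List.append_nil] at ho
    exact ⟨by simp [Expr.cost]; omega, ho ▸ hW, r6⟩
  · obtain ⟨hm₁, r16, r11, hr₁⟩ := hs₁
    refine ⟨fun a _ _ => by rw [hm₁], ?_, ?_, fun i hi => by rw [hm₁]; exact H.zero i hi, 0, [], r11,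
      by omega, by rw [hfull]; simp, ?_, r16, by simp⟩
    · obtain ⟨a0, a1, a2, a3, a4, a5, a7, a17⟩ := H.regs
      constructor <;> (rw [hr₁ _ (by decide) (by decide)]; assumption)
    · rw [hr₁ 6 (by decide) (by decide), h6]
    · rw [Nat.sub_zero, zero_mul, ← hfull, ← Finset.range_eq_Ico, ← hS]
  · obtain ⟨hW, r6⟩ := hs₂
    simp [Prog.wp, Expr.nat, Expr.Fits, hW.1, r6]
    exact ⟨hfM, hW.2⟩

/-! ### The theorem -/

theorem output_two_mul (D : ℕ → ℕ) (m : ℕ) :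
    output D 0 (2 * m) = parens (fun r => D (2 * r)) (fun r => D (2 * r + 1)) 0 m := by
  induction m with
  | zero => rfl
  | succ m ih =>
    rw [mul_add, output_add, ih, parens_add]
    simp [output, parens, List.range'_succ, Nat.add_mod]

/-- Ranks start at 1, so the counters 0 and 1 are zero, as are those beyond 2n + 1 that only fill
the last chunk; dropping the former accounts for the shift between ranks and positions. -/
theorem output_endpoints {n N : ℕ} {l : List (ℕ × ℕ)} (hN : 2 * n + 2 ≤ N)
    (hl : ∀ I ∈ l, 1 ≤ I.1 ∧ I.1 ≤ I.2 ∧ I.2 ≤ n) :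
    output (endpoints l) 0 N = boundaries l 0 n := by
  obtain ⟨d, rfl⟩ : ∃ d, N = 2 * (n + 1) + d := ⟨N - (2 * n + 2), by omega⟩
  have h0 : output (endpoints l) (0 + 2 * (n + 1)) d = [] := by
    refine List.flatMap_eq_nil_iff.2 fun i hi => ?_
    rw [List.mem_range'_1] at hi
    have : endpoints l i = 0 := by
      rw [endpoints, Nat.add_eq_zero_iff, List.countP_eq_zero, List.countP_eq_zero]
      constructor <;>
      · intro I hI
        have := hl I hI
        simp only [beq_iff_eq]
        omega
    rw [this]; rfl
  have hL : ∀ r, endpoints l (2 * r) = l.countP fun I => I.1 == r := by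
    intro r
    rw [endpoints, Nat.add_eq_left.2]
    · exact List.countP_congr fun I _ => by simp only [beq_iff_eq]; omega
    · rw [List.countP_eq_zero]; intro I _; simp only [beq_iff_eq]; omega
  have hR : ∀ r, endpoints l (2 * r + 1) = l.countP fun I => I.2 == r := by
    intro r
    rw [endpoints, Nat.add_eq_right.2]
    · exact List.countP_congr fun I _ => by simp only [beq_iff_eq]; omega
    · rw [List.countP_eq_zero]; intro I _; simp only [beq_iff_eq]; omega
  rw [output_add, h0, List.append_nil, output_two_mul, add_comm n 1, parens_add]
  simp only [hL, hR]
  have h1 : parens (fun r => l.countP fun I => I.1 == r) (fun r => l.countP fun I => I.2 == r) 0 1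
      = [] := by
    have e1 : (l.countP fun I => I.1 == 0) = 0 := by
      rw [List.countP_eq_zero]; intro I hI; have := hl I hI; simp only [beq_iff_eq]; omega
    have e2 : (l.countP fun I => I.2 == 0) = 0 := by
      rw [List.countP_eq_zero]; intro I hI; have := hl I hI; simp only [beq_iff_eq]; omega
    simp [parens, e1, e2]
  rw [h1, List.nil_append, boundaries, parens, parens,
    show List.range' (0 + 1) n = (List.range' 0 n).map (1 + ·) by rw [List.map_add_range'],
    List.flatMap_map]
  refine List.flatMap_congr fun r _ => ?_
  rw [add_comm 1 r]

/-- Take the least `h ≥ 1` with n ≤ 16^h; minimality gives 16^h ≤ 16n. The 9 extra bits of a word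
give 256n ≤ 2^w, enough for all addresses. -/
theorem exists_params {n w : ℕ} (hn : 1 ≤ n) (hw : Nat.log 2 n + 9 ≤ w) :
    ∃ h X L nc M, Params n w h X L nc M ∧
      M = L + h + 2 * nc + 2 * (4 * n / h) + 4 * n / w + 1 := by
  classical
  have hex : ∃ h, 1 ≤ h ∧ n ≤ 4 ^ h * 4 ^ h :=
    ⟨n, hn, (Nat.lt_pow_self (by omega)).le.trans (Nat.le_mul_self _)⟩
  obtain ⟨h, hh⟩ : ∃ h, h = Nat.find hex := ⟨_, rfl⟩
  obtain ⟨h1, h2⟩ := Nat.find_spec hex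
  have hmin : ∀ m, 1 ≤ m → n ≤ 4 ^ m * 4 ^ m → h ≤ m :=
    fun m h1 h2 => hh ▸ Nat.find_min' hex ⟨h1, h2⟩
  rw [← hh] at h1 h2
  have hle : 4 ^ h * 4 ^ h ≤ 16 * n := by
    rcases h1.lt_or_eq with h3 | rfl
    · have h4 := mt (hmin (h - 1) (by omega)) (by omega)
      have h5 : 4 ^ h = 4 * 4 ^ (h - 1) := by
        rw [← pow_succ']; congr 1; omega
      rw [h5, show 4 * 4 ^ (h - 1) * (4 * 4 ^ (h - 1)) = 16 * (4 ^ (h - 1) * 4 ^ (h - 1)) by ring]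
      omega
    · omega
  have hnw : 256 * n ≤ 2 ^ w := by
    have h3 : n < 2 ^ (Nat.log 2 n + 1) := Nat.lt_pow_succ_log_self (by omega) n
    have h4 : 2 ^ (Nat.log 2 n + 9) ≤ 2 ^ w := Nat.pow_le_pow_right (by omega) hw
    rw [show Nat.log 2 n + 9 = Nat.log 2 n + 1 + 8 by omega, pow_add _ _ 8] at h4
    omega
  have hhX : h < 4 ^ h := Nat.lt_pow_self (by omega)
  refine ⟨h, 4 ^ h, 4 ^ h * h, (2 * n + 2) / h + 1, _, ⟨hn, h1, rfl, rfl, h2, hle, hmin, rfl, hnw,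
    le_rfl, ?_⟩, rfl⟩
  have h3 : 4 ^ h * h ≤ 4 ^ h * 4 ^ h := Nat.mul_le_mul_left _ hhX.le
  have h4 := Nat.le_mul_self (4 ^ h)
  have h5 := Nat.div_le_self (2 * n + 2) h
  have h6 := Nat.div_le_self (4 * n) h
  have h7 := Nat.div_le_self (4 * n) w
  omega

/-- From n ≤ 16^h follows log₂ n + 1 ≤ 5h, so w ≤ 5ah. The numbers of chunks and pool records are
O(n/h), which cancels this factor; the table costs X · h · w ≤ 5a · X · h² ≤ 5a · X², by h² ≤ 4^h.
Only the output term is free of `a`. -/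
theorem space_le {n w h X L nc M a : ℕ} (P : Params n w h X L nc M)
    (hM : M = L + h + 2 * nc + 2 * (4 * n / h) + 4 * n / w + 1)
    (hw : w ≤ a * (Nat.log 2 n + 1)) : (19 + M) * w ≤ (400 * a + 4) * n := by
  have hn1 := P.one_le_n
  have hh1 := P.one_le_h
  have hh := P.h_le_n
  have hlog : Nat.log 2 n + 1 ≤ 5 * h := by
    have h1 : n ≤ 2 ^ (4 * h) := by
      have := P.n_le
      rw [P.X_eq, ← mul_pow] at this
      rwa [pow_mul]
    have h2 := (Nat.log_mono_right (b := 2) h1).trans_eq (Nat.log_pow (by omega) _)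
    omega
  have hw5 : w ≤ 5 * a * h :=
    hw.trans ((Nat.mul_le_mul_left a hlog).trans_eq (by ring))
  have hhX : h * h ≤ X := by
    have h1 : h < 2 ^ h := Nat.lt_pow_self (by omega)
    rw [P.X_eq, show 4 = 2 * 2 from rfl, mul_pow]
    exact Nat.mul_self_le_mul_self h1.le
  have t1 : 4 * n / w * w ≤ 4 * n := Nat.div_mul_le_self _ _
  have t2 : 4 * n / h * w ≤ 20 * (a * n) :=
    calc 4 * n / h * w ≤ 4 * n / h * (5 * a * h) := Nat.mul_le_mul_left _ hw5
      _ = 5 * a * (4 * n / h * h) := by ring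
      _ ≤ 5 * a * (4 * n) := Nat.mul_le_mul_left _ (Nat.div_mul_le_self _ _)
      _ = 20 * (a * n) := by ring
  have t3 : nc * w ≤ 25 * (a * n) :=
    calc nc * w ≤ nc * (5 * a * h) := Nat.mul_le_mul_left _ hw5
      _ = 5 * a * (nc * h) := by ring
      _ ≤ 5 * a * (5 * n) := Nat.mul_le_mul_left _ (by have := P.nc_mul_le; omega)
      _ = 25 * (a * n) := by ring
  have t4 : L * w ≤ 80 * (a * n) :=
    calc L * w ≤ L * (5 * a * h) := Nat.mul_le_mul_left _ hw5
      _ = 5 * a * (X * (h * h)) := by rw [P.L_eq]; ring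
      _ ≤ 5 * a * (X * X) := Nat.mul_le_mul_left _ (Nat.mul_le_mul_left _ hhX)
      _ ≤ 5 * a * (16 * n) := Nat.mul_le_mul_left _ P.le_n
      _ = 80 * (a * n) := by ring
  have t5 : h * w ≤ 80 * (a * n) :=
    calc h * w ≤ h * (5 * a * h) := Nat.mul_le_mul_left _ hw5
      _ = 5 * a * (h * h) := by ring
      _ ≤ 5 * a * (16 * n) := Nat.mul_le_mul_left _ (hhX.trans P.X_le)
      _ = 80 * (a * n) := by ring
  have t6 : w ≤ 5 * (a * n) :=
    calc w ≤ 5 * a * h := hw5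
      _ ≤ 5 * a * n := Nat.mul_le_mul_left _ hh
      _ = 5 * (a * n) := by ring
  rw [hM, show (19 + (L + h + 2 * nc + 2 * (4 * n / h) + 4 * n / w + 1)) * w =
    L * w + h * w + 2 * (nc * w) + 2 * (4 * n / h * w) + 4 * n / w * w + 20 * w by ring,
    show (400 * a + 4) * n = 400 * (a * n) + 4 * n by ring]
  omega

theorem Enumerator.Yields.length_lt {E : Enumerator} {s : E.State} {l : List (ℕ × ℕ)} {c : ℕ}
    (h : E.Yields s l c) : l.length + 1 ≤ c := by
  induction h with
  | done s h => exact E.one_le_nextCost s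
  | more s I l c h hl ih =>
    have := E.one_le_nextCost s
    simp only [List.length_cons]
    omega

theorem runs_topology {n w h X L nc M : ℕ} (P : Params n w h X L nc M) {E : Enumerator}
    {s : Store 19} {e : E.State} (h0 : s.reg 0 = n) (h1 : s.reg 1 = w) {l : List (ℕ × ℕ)} {t : ℕ}
    (hy : E.Yields (E.start e) l t) (hl : l.length ≤ 2 * n)
    (hb : ∀ I ∈ l, 1 ≤ I.1 ∧ I.1 ≤ I.2 ∧ I.2 ≤ n) (hD : (boundaries l 0 n).length ≤ 4 * n) :
    Runs E w M topology s e (E.startCost e + t + 3000 * n) fun s' _ =>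
      s'.reg 1 = (boundaries l 0 n).length ∧ ∀ (i : ℕ) (hi : i < (boundaries l 0 n).length),
        s'.reg 0 + i / w < M ∧ (s'.mem (s'.reg 0 + i / w)).testBit (i % w) = (boundaries l 0 n)[i] := by
  have hL := P.L_le
  have hh := P.h_le_n
  have hnc := P.nc_le
  have hn := P.one_le_n
  have hN := P.lt_nc_mul
  refine Runs.mono (T := 10 * n + ((7 + 40 * L) + ((10 * h + 4) + ((10 * nc + 10) +
    ((E.startCost e + t + 101 * l.length + 1) + 1000 * n))))) (Runs.seq (runs_chooseSize P h0 h1) ?_)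
    (by omega) fun _ _ h => h
  rintro s₁ e₁ ⟨rfl, a0, a1, a2, a3⟩
  refine Runs.seq (runs_fillTable P a0 a1 a2 a3) ?_
  rintro s₂ e₂ ⟨rfl, b0, b1, b2, b3, b17, b7, b11, btab⟩
  refine Runs.seq (runs_clearCounters P b0 b1 b2 b3 b17 b7 b11 btab) ?_
  rintro s₃ e₃ ⟨rfl, c0, c1, c2, c3, c17, c7, c4, c11, ctab, ccnt⟩
  refine Runs.seq (runs_initChunks P c0 c1 c2 c3 c17 c7 c4 c11 ctab ccnt) ?_
  rintro s₄ e₄ ⟨rfl, hr, h6, dtab, dcnt, dz⟩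
  refine Runs.seq (runs_countEndpoints P hr h6 dtab dcnt dz hy hl hb) ?_
  rintro s₅ e₅ ⟨cv, pv, H⟩
  have ho := output_endpoints (N := nc * h) (by omega) hb
  refine Runs.mono (runs_emitAll P H (by omega) rfl (by rw [ho]; exact hD)) le_rfl ?_
  rw [ho]
  rintro s₆ e₆ ⟨r1, r0, hf, hbits⟩
  refine ⟨r1, fun i hi => ⟨?_, ?_⟩⟩
  · have : i / w ≤ 4 * n / w := Nat.div_le_div_right (by omega)
    rw [r0]; omega
  · rw [r0]; exact hbits i hi

end TreeTopology

theorem mainTheorem6 :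
    ∃ (k : ℕ) (P : TreeTopology.Prog (k + 2)) (κ : ℕ), ∀ a : ℕ, ∃ C : ℕ,
      ∀ (σ : ℕ) (T : List (Fin σ)) (n w : ℕ), n = T.length + 1 →
        Nat.log 2 n + κ ≤ w → w ≤ a * (Nat.log 2 n + 1) →
      ∀ (E : TreeTopology.Enumerator) (te : ℝ),
        E.EnumeratesIntervals (TreeTopology.terminated T) te →
      ∀ s : TreeTopology.Config (k + 2) w E,
        s.regs 0 = BitVec.ofNat w n → s.regs 1 = BitVec.ofNat w w →
      ∃ (M t : ℕ) (s' : TreeTopology.Config (k + 2) w E),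
        TreeTopology.Exec E w M P s t s' ∧
        (t : ℝ) ≤ C * n * te ∧
        (k + 2 + M) * w ≤ C * n ∧
        (s'.regs 1).toNat = (TreeTopology.suffixTree T).bp.length ∧
        TreeTopology.StoredBits M s'.mem (s'.regs 0).toNat (TreeTopology.suffixTree T).bp := by
  -- The program uses 17 + 2 registers. In the constant, 400a serves the space, and 4000 exceeds
  -- both the 4 + 3000 of the time bound and the additive 4 of the space bound.
  refine ⟨17, TreeTopology.topology, 9, fun a => ⟨400 * a + 4000, ?_⟩⟩
  intro σ T n w hn hκ hw E te hE s h0 h1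
  have hn1 : 1 ≤ n := by omega
  obtain ⟨h, X, L, nc, M, P, hM⟩ := TreeTopology.exists_params hn1 hκ
  obtain ⟨l, c, hy, hnd, hmem, hc⟩ := hE s.enum
  obtain ⟨hbp, hlen, hl, hb⟩ := TreeTopology.bp_suffixTree T hnd hmem
  rw [← hn] at hbp hb
  have hnw : n < 2 ^ w := by have := P.n_lt; omega
  obtain ⟨t, s', hx, ht, hr1, hbits⟩ := TreeTopology.runs_topology P (e := s.enum)
    (s := s.store) (by simp [TreeTopology.Config.store, h0, Nat.mod_eq_of_lt hnw])
    (by simp [TreeTopology.Config.store, h1, Nat.mod_eq_of_lt Nat.lt_two_pow_self]) hy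
    (by omega) hb (by rw [← hbp]; omega) s rfl rfl
  refine ⟨M, t, s', hx, ?_, ?_, ?_, ?_⟩
  · have hle := hy.length_lt
    have hstart := E.one_le_startCost s.enum
    have h2 : ((l.length + 2 : ℕ) : ℝ) ≤ (E.startCost s.enum + c : ℕ) := by
      exact_mod_cast (by omega : l.length + 2 ≤ E.startCost s.enum + c)
    have hpos : (0 : ℝ) < l.length + 2 := by positivity
    -- Every call costs at least one unit, so the average is at least 1 and the O(n) work of the
    -- program is absorbed into n · te.
    have hte : 1 ≤ te := by
      push_cast at h2 hc
      by_contra hcon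
      nlinarith
    have hn' : (1 : ℝ) ≤ n := by exact_mod_cast hn1
    have hl' : (l.length : ℝ) + 2 ≤ 4 * n := by exact_mod_cast (by omega : l.length + 2 ≤ 4 * n)
    have ht' : (t : ℝ) ≤ (E.startCost s.enum + c : ℕ) + 3000 * n := by exact_mod_cast ht
    have ha : (0 : ℝ) ≤ a := Nat.cast_nonneg a
    have h3 : te * (l.length + 2) ≤ te * (4 * n) := mul_le_mul_of_nonneg_left hl' (by linarith)
    have h4 : (n : ℝ) * 1 ≤ n * te := mul_le_mul_of_nonneg_left hte (by linarith)
    have h5 : 0 ≤ a * ((n : ℝ) * te) := by positivity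
    push_cast
    nlinarith
  · refine (TreeTopology.space_le P hM hw).trans (Nat.mul_le_mul_right n (by omega))
  · rw [hbp]; exact hr1
  · intro i hi
    simp only [hbp] at hi ⊢
    exact hbits i hi
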